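/- Let $k$ be a field of characteristic zero, $n \ge 0$, $R = k[x_1,\dots,x_n]$ and $\widehat R = k[[x_1,\dots,x_n]]$. Let $\mathscr D = \mathscr D(R,k)$ and $\widehat{\mathscr D} = \mathscr D(\widehat R,k)$ be the rings of $k$-linear differential operators on $R$ and on $\widehat R$; they are generated over $R$ (resp. $\widehat R$) by the partial derivatives $\partial_1,\dots,\partial_n$, and $\mathscr D\subseteq\widehat{\mathscr D}$. For a left $\mathscr D$-module $M$ let $\widehat M = \widehat R\otimes_R M$, a left $\widehat{\mathscr D}$-module by $\partial_i(s\otimes m)=\partial_i(s)\otimes m+s\otimes\partial_i m$, and let $\kappa: M\to\widehat M$, $\kappa(m)=1\otimes m$. For a left module $N$ over $\mathscr D$ or $\widehat{\mathscr D}$, let $\Omega^\bullet(N)$ be its de Rham complex: $\Omega^i(N)=\bigoplus_{j_1<\dots<j_i} N\,dx_{j_1}\wedge\dots\wedge dx_{j_i}$ with $d(m\,dx_{j_1}\wedge\dots\wedge dx_{j_i})=\sum_{s=1}^n \partial_s m\,dx_s\wedge dx_{j_1}\wedge\dots\wedge dx_{j_i}$, and let $H^i_{\mathrm{dR}}(N)$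 be its cohomology, a $k$-space. Let $\tau$ be the standard transposition, $\tau(f\partial^\alpha)=(-1)^{|\alpha|}\partial^\alpha f$, and let $R^\tau$ (resp. $\widehat R^\tau$) be the right $\mathscr D$-module $R$ (resp. right $\widehat{\mathscr D}$-module $\widehat R$) with action $r\cdot\delta=\tau(\delta)(r)$. The map $\kappa$ induces $\kappa^i: H^i_{\mathrm{dR}}(M)\to H^i_{\mathrm{dR}}(\widehat M)$ by applying $\kappa$ to every summand of $\Omega^\bullet(M)$, and, together with the inclusions $\mathscr D\subseteq\widehat{\mathscr D}$ and $R^\tau\subseteq\widehat R^\tau$, it induces $\iota_j:\operatorname{Tor}^{\mathscr D}_j(R^\tau,M)\to\operatorname{Tor}^{\widehat{\mathscr D}}_j(\widehat R^\tau,\widehat M)$. For every left $\mathscr D$-module $M$ and every $i$ with $0\le i\le n$ there is a commutative square of $k$-linear maps $$\begin{array}{ccc} H^i_{\mathrm{dR}}(M) & \longrightarrow & \operatorname{Tor}^{\mathscr D}_{n-i}(R^\tau,M)\\ {\scriptstyle\kappa^i}\big\downarrow & & \big\downarrow{\scriptstyle\iota_{n-i}}\\ H^i_{\mathrm{dR}}(\widehat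 M) & \longrightarrow & \operatorname{Tor}^{\widehat{\mathscr D}}_{n-i}(\widehat R^\tau,\widehat M)\end{array}$$ whose horizontal maps are isomorphisms. More precisely, the horizontal maps are the canonical ones: if $F_\bullet\to M$ is a free resolution, the upper one is induced by the two augmentations $$\Omega^\bullet(M)\longleftarrow \operatorname{Tot}\,\Omega^\bullet(F_\bullet)\longrightarrow R^\tau\otimes_{\mathscr D}F_\bullet ,$$ the first given by $F_0\to M$ and the second by $\Omega^n(F_j)\to R^\tau\otimes_{\mathscr D}F_j$, $m\,dx_1\wedge\dots\wedge dx_n\mapsto 1\otimes m$; the lower one is the analogous map for $\widehat M$ over $\widehat{\mathscr D}$. For $i>n$ the spaces $H^i_{\mathrm{dR}}(M)$ and $H^i_{\mathrm{dR}}(\widehat M)$ vanish, as do, by convention, the Tor spaces in negative degrees $n-i$. -/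

import Mathlib

open scoped TensorProduct
open MulOpposite

noncomputable section

universe u v w

set_option linter.unusedSectionVars false

/-! ### Rings of differential operators -/

/-- `IsDiffOpLT k A m P`: the `k`-linear endomorphism `P` of the commutative `k`-algebra `A` is a
differential operator of order `< m`. Order `< 0` means `P = 0`; order `< m + 1` means that every
commutator `[P, a]` with a multiplication operator has order `< m`. -/
def IsDiffOpLT (k : Type u) (A : Type v) [CommRing k] [CommRing A] [Algebra k A] :
    ℕ → Module.End k A → Prop
  | 0, P => P = 0
  | m + 1, P => ∀ a : A, IsDiffOpLT k A m (P * Algebra.lmul k A a - Algebra.lmul k A a * P)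

section DiffOp

variable {k : Type u} {A : Type v} [CommRing k] [CommRing A] [Algebra k A]

theorem IsDiffOpLT.zero (m : ℕ) : IsDiffOpLT k A m 0 := by
  induction m with
  | zero => rfl
  | succ m ih => intro a; simpa using ih

theorem IsDiffOpLT.add {m : ℕ} {P Q : Module.End k A} (hP : IsDiffOpLT k A m P)
    (hQ : IsDiffOpLT k A m Q) : IsDiffOpLT k A m (P + Q) := by
  induction m generalizing P Q with
  | zero => simp only [IsDiffOpLT] at *; simp [hP, hQ]
  | succ m ih =>
    intro a
    convert ih (hP a) (hQ a) using 1
    noncomm_ring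

theorem IsDiffOpLT.succ {m : ℕ} {P : Module.End k A} (hP : IsDiffOpLT k A m P) :
    IsDiffOpLT k A (m + 1) P := by
  induction m generalizing P with
  | zero => intro a; simp only [IsDiffOpLT] at *; simp [hP]
  | succ m ih => intro a; exact ih (hP a)

theorem IsDiffOpLT.mono {m l : ℕ} (h : m ≤ l) {P : Module.End k A} (hP : IsDiffOpLT k A m P) :
    IsDiffOpLT k A l P := by
  induction h with
  | refl => exact hP
  | step _ ih => exact ih.succ

theorem IsDiffOpLT.mul {p q : ℕ} {P Q : Module.End k A} (hP : IsDiffOpLT k A p P)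
    (hQ : IsDiffOpLT k A q Q) : IsDiffOpLT k A (p + q) (P * Q) := by
  induction p generalizing P q Q with
  | zero =>
    simp only [IsDiffOpLT] at hP
    simpa [hP] using IsDiffOpLT.zero _
  | succ p ihp =>
    induction q generalizing P Q with
    | zero =>
      simp only [IsDiffOpLT] at hQ
      simpa [hQ] using IsDiffOpLT.zero _
    | succ q ihq =>
      intro a
      have h1 := ihq hP (hQ a)
      have h2 := ihp (hP a) hQ
      have h2' := h2.mono (l := p + 1 + q) (by omega)
      have h3 := h1.add h2'
      have e : P * Q * Algebra.lmul k A a - Algebra.lmul k A a * (P * Q)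
          = P * (Q * Algebra.lmul k A a - Algebra.lmul k A a * Q)
            + (P * Algebra.lmul k A a - Algebra.lmul k A a * P) * Q := by
        rw [mul_sub, sub_mul]
        simp only [mul_assoc]
        abel
      rw [← e] at h3
      exact h3

theorem IsDiffOpLT.lmul (a : A) : IsDiffOpLT k A 1 (Algebra.lmul k A a) := by
  intro b
  show _ = _
  rw [← map_mul, ← map_mul, mul_comm, sub_self]

theorem IsDiffOpLT.lmul_mul {m : ℕ} {P : Module.End k A} (hP : IsDiffOpLT k A m P) (b : A) :
    IsDiffOpLT k A m (Algebra.lmul k A b * P) := by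
  induction m generalizing P with
  | zero => simp only [IsDiffOpLT] at *; simp [hP]
  | succ m ih =>
    intro a
    convert ih (hP a) using 1
    rw [mul_sub, ← mul_assoc, ← mul_assoc, ← mul_assoc, ← map_mul, ← map_mul, mul_comm a b]

theorem lmul_comm_derivation (D : Derivation k A A) (a : A) :
    (D : A →ₗ[k] A) * Algebra.lmul k A a
      = Algebra.lmul k A a * (D : A →ₗ[k] A) + Algebra.lmul k A (D a) := by
  ext b
  simp [mul_comm]

theorem IsDiffOpLT.derivation_mul {m : ℕ} {P : Module.End k A} (hP : IsDiffOpLT k A m P)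
    (D : Derivation k A A) :
    IsDiffOpLT k A (m + 1) (((D : A →ₗ[k] A) : Module.End k A) * P) := by
  induction m generalizing P with
  | zero => simp only [IsDiffOpLT] at hP; simpa [hP] using IsDiffOpLT.zero _
  | succ m ih =>
    intro a
    convert (ih (hP a)).add (hP.lmul_mul (D a)) using 1
    rw [mul_sub, ← mul_assoc, ← mul_assoc, ← mul_assoc, lmul_comm_derivation]
    noncomm_ring

variable (k A) in
/-- The ring `𝒟(A, k)` of `k`-linear differential operators on `A`, as a subalgebra of
`End_k(A)`. -/
def diffOps : Subalgebra k (Module.End k A) where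
  carrier := {P | ∃ m, IsDiffOpLT k A m P}
  mul_mem' := by
    rintro P Q ⟨p, hP⟩ ⟨q, hQ⟩
    exact ⟨p + q, hP.mul hQ⟩
  add_mem' := by
    rintro P Q ⟨p, hP⟩ ⟨q, hQ⟩
    exact ⟨p + q, (hP.mono (by omega)).add (hQ.mono (by omega))⟩
  algebraMap_mem' c := by
    refine ⟨1, ?_⟩
    have := IsDiffOpLT.lmul (k := k) (algebraMap k A c)
    rwa [AlgHom.commutes] at this

variable (k A) in
/-- The ring `𝒟(A, k)`, as a type. It acts on `A` by evaluation. -/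
def DiffOp : Type v := diffOps k A

instance : Ring (DiffOp k A) := inferInstanceAs (Ring (diffOps k A))

instance : Algebra k (DiffOp k A) := inferInstanceAs (Algebra k (diffOps k A))

instance : Module (DiffOp k A) A := inferInstanceAs (Module (diffOps k A) A)

instance : IsScalarTower k (DiffOp k A) A := inferInstanceAs (IsScalarTower k (diffOps k A) A)

/-- Multiplication operators as differential operators. -/
def DiffOp.mulOp : A →ₐ[k] DiffOp k A :=
  (Algebra.lmul k A).codRestrict (diffOps k A) fun a => ⟨1, IsDiffOpLT.lmul a⟩

/-- Derivations as differential operators. -/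
def DiffOp.ofDerivation (D : Derivation k A A) : DiffOp k A :=
  ⟨(D : A →ₗ[k] A), 2, by
    have h := (IsDiffOpLT.lmul (k := k) (1 : A)).derivation_mul D
    rwa [map_one, mul_one] at h⟩

/-- `A` acts on `𝒟(A, k)` by left multiplication. -/
instance : Module A (DiffOp k A) := Module.compHom _ (DiffOp.mulOp (k := k) (A := A)).toRingHom

theorem DiffOp.smul_def (a : A) (P : DiffOp k A) : a • P = DiffOp.mulOp a * P := rfl

instance : IsScalarTower A (DiffOp k A) (DiffOp k A) := ⟨fun _ P Q => mul_assoc _ P Q⟩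

instance : IsScalarTower k A (DiffOp k A) := ⟨fun c a P => by
  simp [DiffOp.smul_def]⟩

@[simp] theorem DiffOp.mulOp_smul (a b : A) : (DiffOp.mulOp a : DiffOp k A) • b = a * b := rfl

@[simp] theorem DiffOp.ofDerivation_smul (D : Derivation k A A) (b : A) :
    DiffOp.ofDerivation D • b = D b := rfl

end DiffOp

/-! ### Monomials in commuting elements -/

section Monomials

variable {n : ℕ} {E : Type w} [Monoid E]

/-- `d_1^{α_1} ⋯ d_n^{α_n}` -/
def opMon (d : Fin n → E) (α : Fin n →₀ ℕ) : E := ((List.finRange n).map fun i => d i ^ α i).prod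

theorem opMon_zero (d : Fin n → E) : opMon d 0 = 1 := by
  simp [opMon]

theorem opMon_add_single (d : Fin n → E) (hd : ∀ i j, Commute (d i) (d j)) (α : Fin n →₀ ℕ)
    (i : Fin n) : opMon d (α + Finsupp.single i 1) = d i * opMon d α := by
  have key : ∀ l : List (Fin n), l.Nodup →
      (i ∈ l → (l.map fun j => d j ^ (α + Finsupp.single i 1 : Fin n →₀ ℕ) j).prod
        = d i * (l.map fun j => d j ^ α j).prod) ∧
      (i ∉ l → (l.map fun j => d j ^ (α + Finsupp.single i 1 : Fin n →₀ ℕ) j).prod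
        = (l.map fun j => d j ^ α j).prod) := by
    intro l
    induction l with
    | nil => simp
    | cons j l ih =>
      intro hl
      obtain ⟨hj, hl⟩ := List.nodup_cons.mp hl
      obtain ⟨h1, h2⟩ := ih hl
      simp only [List.map_cons, List.prod_cons]
      by_cases hij : j = i
      · subst hij
        refine ⟨fun _ => ?_, fun h => absurd List.mem_cons_self h⟩
        rw [h2 hj]
        simp [pow_succ', mul_assoc]
      · have e : (α + Finsupp.single i 1 : Fin n →₀ ℕ) j = α j := by simp [Ne.symm hij]
        rw [e]
        refine ⟨fun h => ?_, fun h => ?_⟩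
        · have hi : i ∈ l := (List.mem_cons.mp h).resolve_left (Ne.symm hij)
          rw [h1 hi, ← mul_assoc, ← mul_assoc, ((hd i j).pow_right _).eq]
        · rw [h2 fun hi => h (List.mem_cons_of_mem _ hi)]
  exact (key _ (List.nodup_finRange n)).1 (List.mem_finRange i)

theorem opMon_induction {p : (Fin n →₀ ℕ) → Prop} (h0 : p 0)
    (h1 : ∀ α i, p α → p (α + Finsupp.single i 1)) (α : Fin n →₀ ℕ) : p α := by
  have key : ∀ (m : ℕ) (i : Fin n) (β : Fin n →₀ ℕ), p β → p (β + Finsupp.single i m) := by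
    intro m i β hβ
    induction m with
    | zero => simpa using hβ
    | succ m ih => simpa [Finsupp.single_add, add_assoc] using h1 _ i ih
  induction α using Finsupp.induction with
  | zero => exact h0
  | single_add i m β _ _ ih => rw [add_comm]; exact key m i β ih

end Monomials

/-! ### Algebras with coordinates

The polynomial ring and the ring of formal power series are treated uniformly: both carry
coordinates `x_i` and commuting partial derivatives `∂_i` with `∂_i(x_j) = δ_{ij}`, and on both of
them a differential operator is determined by its values on the monomials. -/

/-- `x_1^{β_1} ⋯ x_n^{β_n}` -/
def coordMon {n : ℕ} {A : Type v} [CommRing A] (x : Fin n → A) (β : Fin n →₀ ℕ) : A :=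
  β.prod fun i e => x i ^ e

/-- Coordinates on a `k`-algebra. The two instances below are the polynomial ring and the ring of
formal power series. -/
class Coordinates (k : Type u) [Field k] (A : Type v) [CommRing A] [Algebra k A]
    (n : outParam ℕ) where
  x : Fin n → A
  pd : Fin n → Derivation k A A
  pd_comm : ∀ i j a, pd i (pd j a) = pd j (pd i a)
  pd_x : ∀ i j, pd i (x j) = if i = j then 1 else 0
  ext_mon : ∀ P : Module.End k A, P ∈ diffOps k A → (∀ β, P (coordMon x β) = 0) → P = 0

section PBW

variable {k : Type u} [Field k] {A : Type v} [CommRing A] [Algebra k A] {n : ℕ}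

theorem coordMon_zero (x : Fin n → A) : coordMon x 0 = 1 := Finsupp.prod_zero_index

theorem coordMon_add_single (x : Fin n → A) (β : Fin n →₀ ℕ) (i : Fin n) :
    coordMon x (β + Finsupp.single i 1) = x i * coordMon x β := by
  rw [coordMon, Finsupp.prod_add_index' (by simp) (by intros; rw [pow_add]),
    Finsupp.prod_single_index (by simp), pow_one, mul_comm]
  rfl

/-- `∑ c_α d^α` in a `k`-algebra `E` under `A`. -/
def opExpand {E : Type w} [Ring E] [Algebra k E] (φ : A →ₐ[k] E) (d : Fin n → E) :
    ((Fin n →₀ ℕ) →₀ A) →ₗ[k] E :=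
  Finsupp.lsum k fun α => (LinearMap.mulRight k (opMon d α)) ∘ₗ φ.toLinearMap

theorem opExpand_single {E : Type w} [Ring E] [Algebra k E] (φ : A →ₐ[k] E) (d : Fin n → E)
    (α : Fin n →₀ ℕ) (a : A) : opExpand φ d (Finsupp.single α a) = φ a * opMon d α := by
  simp [opExpand]

theorem natCast_isUnit [CharZero k] (c : ℕ) (hc : c ≠ 0) : IsUnit (c : A) := by
  have : IsUnit (c : k) := (Nat.cast_ne_zero.mpr hc).isUnit
  simpa using this.map (algebraMap k A)

theorem finsupp_eq_of_le_of_degree_le {β α : Fin n →₀ ℕ} (h : β ≤ α)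
    (hd : α.degree ≤ β.degree) : β = α := by
  obtain ⟨γ, rfl⟩ := exists_add_of_le h
  rw [map_add] at hd
  have : γ = 0 := (Finsupp.degree_eq_zero_iff γ).mp (by omega)
  rw [this, add_zero]

variable [Coordinates k A n]

open Coordinates

variable (k A) in
/-- The operator `∂_i` as an element of `𝒟(A, k)`. -/
def dd (i : Fin n) : DiffOp k A := DiffOp.ofDerivation (pd i)

theorem dd_comm (i j : Fin n) : Commute (dd k A i) (dd k A j) :=
  Subtype.ext (LinearMap.ext fun a => pd_comm i j a)

theorem dd_mulOp (i : Fin n) (a : A) :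
    dd k A i * DiffOp.mulOp a = DiffOp.mulOp a * dd k A i + DiffOp.mulOp (pd (k := k) i a) :=
  Subtype.ext (lmul_comm_derivation _ a)

theorem pd_coordMon (i : Fin n) (β : Fin n →₀ ℕ) :
    pd (k := k) i (coordMon (x k : Fin n → A) β)
      = (β i : A) * coordMon (x k) (β - Finsupp.single i 1) := by
  induction β using opMon_induction with
  | h0 => simp [coordMon_zero]
  | h1 β j ih =>
    rw [coordMon_add_single, Derivation.leibniz, ih, pd_x]
    by_cases hij : i = j
    · subst hij
      have e : β + Finsupp.single i 1 - Finsupp.single i 1 = β := by simp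
      rw [e]
      by_cases h0 : β i = 0
      · simp [h0]
      · have e2 : β - Finsupp.single i 1 + Finsupp.single i 1 = β := by
          ext l
          by_cases hl : i = l
          · subst hl; simp; omega
          · simp [Finsupp.single_eq_of_ne' hl]
        have e3 := coordMon_add_single (x k : Fin n → A) (β - Finsupp.single i 1) i
        rw [e2] at e3
        simp only [smul_eq_mul, if_true, mul_one, Finsupp.add_apply, Finsupp.single_eq_same]
        rw [mul_left_comm, ← e3]
        push_cast
        ring
    · have hji : (Finsupp.single j 1 : Fin n →₀ ℕ) i = 0 := Finsupp.single_eq_of_ne hij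
      by_cases h0 : β i = 0
      · simp [h0, hji, hij]
      · have e2 : β + Finsupp.single j 1 - Finsupp.single i 1
            = β - Finsupp.single i 1 + Finsupp.single j 1 := by
          ext l
          by_cases hl : i = l
          · subst hl; simp [hji]
          · simp [Finsupp.single_eq_of_ne' hl]
        rw [e2, coordMon_add_single]
        simp [hij, hji]
        ring

theorem opMon_dd_commute (α : Fin n →₀ ℕ) (i : Fin n) :
    Commute (dd k A i) (opMon (dd k A) α) := by
  induction α using opMon_induction with
  | h0 => rw [opMon_zero]; exact Commute.one_right _
  | h1 α j ih => rw [opMon_add_single _ dd_comm]; exact (dd_comm i j).mul_right ih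

theorem opMon_dd_coordMon (α : Fin n →₀ ℕ) :
    (∀ β, ¬ α ≤ β → opMon (dd k A) α • coordMon (x k : Fin n → A) β = 0) ∧
      ∃ c : ℕ, c ≠ 0 ∧ opMon (dd k A) α • coordMon (x k : Fin n → A) α = (c : A) := by
  induction α using opMon_induction with
  | h0 =>
    refine ⟨fun β h => absurd (zero_le (a := β)) h, 1, one_ne_zero, ?_⟩
    rw [opMon_zero, one_smul, coordMon_zero, Nat.cast_one]
  | h1 α i ih =>
    obtain ⟨h1, c, hc, h2⟩ := ih
    have key : ∀ β, opMon (dd k A) (α + Finsupp.single i 1) • coordMon (x k : Fin n → A) β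
        = (β i : k) • (opMon (dd k A) α • coordMon (x k : Fin n → A) (β - Finsupp.single i 1)) := by
      intro β
      rw [opMon_add_single _ dd_comm, (opMon_dd_commute α i).eq, mul_smul]
      have : dd k A i • coordMon (x k : Fin n → A) β
          = (β i : k) • coordMon (x k : Fin n → A) (β - Finsupp.single i 1) := by
        rw [dd, DiffOp.ofDerivation_smul, pd_coordMon, Algebra.smul_def, map_natCast]
      rw [this, smul_comm]
    refine ⟨fun β hβ => ?_, (α i + 1) * c, by positivity, ?_⟩
    · rw [key]
      by_cases h0 : β i = 0
      · simp [h0]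
      · rw [h1, smul_zero]
        intro hle
        apply hβ
        intro l
        have := hle l
        by_cases hl : i = l
        · subst hl; simp at this ⊢; omega
        · simpa [Finsupp.single_eq_of_ne' hl] using this
    · rw [key, add_tsub_cancel_right, h2, Algebra.smul_def, map_natCast]
      simp

theorem opExpand_dd_injective [CharZero k] :
    Function.Injective (opExpand (DiffOp.mulOp (k := k) (A := A)) (dd k A)) := by
  refine (injective_iff_map_eq_zero _).mpr ?_
  intro c hc
  by_contra hne
  obtain ⟨α, hα, hmin⟩ := Finset.exists_min_image c.support Finsupp.degree
    (Finsupp.support_nonempty_iff.mpr hne)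
  have h := congrArg (fun P : DiffOp k A => P • coordMon (x k : Fin n → A) α) hc
  simp only [zero_smul] at h
  rw [opExpand, Finsupp.lsum_apply, Finsupp.sum, Finset.sum_smul, Finset.sum_eq_single α] at h
  · obtain ⟨_, N, hN, h2⟩ := opMon_dd_coordMon (k := k) (A := A) α
    simp only [LinearMap.comp_apply, LinearMap.mulRight_apply, AlgHom.toLinearMap_apply, mul_smul,
      h2, DiffOp.mulOp_smul] at h
    rw [(natCast_isUnit (k := k) N hN).mul_left_eq_zero] at h
    exact (Finsupp.mem_support_iff.mp hα) h
  · intro β hβ hβα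
    simp only [LinearMap.comp_apply, LinearMap.mulRight_apply, AlgHom.toLinearMap_apply, mul_smul]
    rw [(opMon_dd_coordMon β).1, smul_zero]
    intro hle
    exact hβα (finsupp_eq_of_le_of_degree_le hle (hmin β hβ))
  · exact fun h => absurd hα h

theorem opMon_dd_order (α : Fin n →₀ ℕ) :
    IsDiffOpLT k A (α.degree + 1) (opMon (dd k A) α : DiffOp k A).1 := by
  induction α using opMon_induction with
  | h0 =>
    rw [opMon_zero, map_zero]
    have := IsDiffOpLT.lmul (k := k) (1 : A)
    rwa [map_one] at this
  | h1 α i ih =>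
    rw [opMon_add_single _ dd_comm, map_add, Finsupp.degree_single]
    exact ih.derivation_mul _

theorem exists_interpolation [CharZero k] (m : ℕ) (g : (Fin n →₀ ℕ) → A) :
    ∃ c, IsDiffOpLT k A m (opExpand (DiffOp.mulOp (k := k) (A := A)) (dd k A) c).1 ∧
      ∀ β : Fin n →₀ ℕ, β.degree < m →
        opExpand (DiffOp.mulOp (k := k) (A := A)) (dd k A) c • coordMon (x k : Fin n → A) β
          = g β := by
  induction m with
  | zero => exact ⟨0, by rw [map_zero]; exact IsDiffOpLT.zero _, fun β h => absurd h (by omega)⟩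
  | succ m ih =>
    obtain ⟨c, hc, hg⟩ := ih
    have hS := Finsupp.finite_of_degree_eq (σ := Fin n) m
    have hN : ∀ α : Fin n →₀ ℕ, ∃ b : A,
        b * (opMon (dd k A) α • coordMon (x k : Fin n → A) α) = g α
          - opExpand (DiffOp.mulOp (k := k) (A := A)) (dd k A) c • coordMon (x k : Fin n → A) α := by
      intro α
      obtain ⟨N, hN, h2⟩ := (opMon_dd_coordMon (k := k) (A := A) α).2
      obtain ⟨u, hu⟩ := natCast_isUnit (k := k) (A := A) N hN
      refine ⟨(g α - opExpand (DiffOp.mulOp (k := k) (A := A)) (dd k A) c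
        • coordMon (x k : Fin n → A) α) * ↑u⁻¹, ?_⟩
      rw [h2, ← hu, mul_assoc, Units.inv_mul, mul_one]
    choose b hb using hN
    have ev : ∀ β : Fin n →₀ ℕ,
        opExpand (DiffOp.mulOp (k := k) (A := A)) (dd k A)
          (∑ α ∈ hS.toFinset, Finsupp.single α (b α)) • coordMon (x k : Fin n → A) β
        = ∑ α ∈ hS.toFinset, b α * (opMon (dd k A) α • coordMon (x k : Fin n → A) β) := by
      intro β
      rw [map_sum, Finset.sum_smul]
      refine Finset.sum_congr rfl fun α _ => ?_
      rw [opExpand_single, mul_smul, DiffOp.mulOp_smul]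
    refine ⟨c + ∑ α ∈ hS.toFinset, Finsupp.single α (b α), ?_, ?_⟩
    · rw [map_add]
      refine IsDiffOpLT.add hc.succ ?_
      rw [map_sum]
      refine Finset.sum_induction _ (fun P : DiffOp k A => IsDiffOpLT k A (m + 1) P.1)
        (fun P Q hP hQ => hP.add hQ) (IsDiffOpLT.zero _) fun α hα => ?_
      rw [opExpand_single]
      have := opMon_dd_order (k := k) (A := A) α
      rw [(hS.mem_toFinset.mp hα : α.degree = m)] at this
      exact this.lmul_mul _
    · intro β hβ
      rw [map_add, add_smul, ev]
      by_cases hlt : β.degree < m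
      · rw [hg β hlt, Finset.sum_eq_zero, add_zero]
        intro α hα
        rw [(opMon_dd_coordMon α).1, mul_zero]
        intro hle
        have := Finsupp.degree_mono hle
        rw [(hS.mem_toFinset.mp hα : α.degree = m)] at this
        omega
      · have hβm : β.degree = m := by omega
        rw [Finset.sum_eq_single β, hb, add_sub_cancel]
        · intro α hα hne
          rw [(opMon_dd_coordMon α).1, mul_zero]
          intro hle
          refine hne (finsupp_eq_of_le_of_degree_le hle ?_)
          rw [(hS.mem_toFinset.mp hα : α.degree = m), hβm]
        · intro h
          exact absurd (hS.mem_toFinset.mpr hβm) h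

theorem IsDiffOpLT.coordMon_eq_zero {m : ℕ} {P : Module.End k A} (hP : IsDiffOpLT k A m P)
    (h : ∀ β : Fin n →₀ ℕ, β.degree < m → P (coordMon (x k : Fin n → A) β) = 0)
    (β : Fin n →₀ ℕ) : P (coordMon (x k : Fin n → A) β) = 0 := by
  induction m generalizing P β with
  | zero => simp only [IsDiffOpLT] at hP; simp [hP]
  | succ m ih =>
    have key : ∀ i (β : Fin n →₀ ℕ), P (x k i * coordMon (x k : Fin n → A) β)
        = x k i * P (coordMon (x k : Fin n → A) β) := by
      intro i β
      have := ih (hP (x k i)) (fun γ hγ => ?_) β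
      · simpa [sub_eq_zero] using this
      · have h1 := h (γ + Finsupp.single i 1) (by
          rw [map_add, Finsupp.degree_single]; omega)
        rw [coordMon_add_single] at h1
        simp [h1, h γ (by omega)]
    induction β using opMon_induction with
    | h0 => exact h 0 (by simp)
    | h1 β i ihβ => rw [coordMon_add_single, key, ihβ, mul_zero]

theorem opExpand_dd_surjective [CharZero k] :
    Function.Surjective (opExpand (DiffOp.mulOp (k := k) (A := A)) (dd k A)) := by
  rintro ⟨P, m, hP⟩
  obtain ⟨c, hc, hg⟩ := exists_interpolation (k := k) m fun β => P (coordMon (x k : Fin n → A) β)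
  refine ⟨c, Subtype.ext (Eq.symm (sub_eq_zero.mp ?_))⟩
  have hneg : IsDiffOpLT k A m
      (P - (opExpand (DiffOp.mulOp (k := k) (A := A)) (dd k A) c).1) := by
    have h1 := hc.lmul_mul (-1)
    have h2 := hP.add h1
    convert h2 using 1
    ext b
    simp [sub_eq_add_neg]
  refine ext_mon _ ⟨m, hneg⟩ (hneg.coordMon_eq_zero fun β hβ => ?_)
  exact sub_eq_zero.mpr (hg β hβ).symm

theorem DiffOp.exists_lift [CharZero k] {E : Type w} [Ring E] [Algebra k E] (φ : A →ₐ[k] E)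
    (d : Fin n → E) (hd : ∀ i j, Commute (d i) (d j))
    (hφ : ∀ i a, d i * φ a = φ a * d i + φ (pd (k := k) i a)) :
    ∃ L : DiffOp k A →ₐ[k] E, (∀ a, L (DiffOp.mulOp a) = φ a) ∧ ∀ i, L (dd k A i) = d i := by
  obtain ⟨s, hs⟩ : ∃ s : DiffOp k A → ((Fin n →₀ ℕ) →₀ A),
      ∀ P, opExpand (DiffOp.mulOp (k := k) (A := A)) (dd k A) (s P) = P :=
    ⟨fun P => (opExpand_dd_surjective P).choose, fun P => (opExpand_dd_surjective P).choose_spec⟩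
  obtain ⟨L, hL⟩ : ∃ L : DiffOp k A → E, ∀ c,
      L (opExpand (DiffOp.mulOp (k := k) (A := A)) (dd k A) c) = opExpand φ d c :=
    ⟨fun P => opExpand φ d (s P), fun c => congrArg _ (opExpand_dd_injective (hs _))⟩
  have hadd : ∀ P Q, L (P + Q) = L P + L Q := by
    intro P Q
    rw [← hs P, ← hs Q, ← map_add, hL, hL, hL, map_add]
  have hL1 : ∀ a α, L (DiffOp.mulOp a * opMon (dd k A) α) = φ a * opMon d α := by
    intro a α
    have h := hL (Finsupp.single α a)
    rwa [opExpand_single, opExpand_single] at h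
  have ind : ∀ (p : DiffOp k A → Prop), (∀ a α, p (DiffOp.mulOp a * opMon (dd k A) α)) →
      (∀ P Q, p P → p Q → p (P + Q)) → ∀ P, p P := by
    intro p h1 h2 P
    rw [← hs P]
    induction s P using Finsupp.induction_linear with
    | zero => rw [map_zero]; simpa using h1 0 0
    | add c c' h h' => rw [map_add]; exact h2 _ _ h h'
    | single α a => rw [opExpand_single]; exact h1 a α
  have hmulOp : ∀ a Q, L (DiffOp.mulOp a * Q) = φ a * L Q := by
    intro a
    refine ind _ (fun b α => ?_) (fun P Q hP hQ => ?_)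
    · rw [← mul_assoc, ← map_mul, hL1, hL1, map_mul, mul_assoc]
    · rw [mul_add, hadd, hadd, hP, hQ, mul_add]
  have hdd : ∀ i Q, L (dd k A i * Q) = d i * L Q := by
    intro i
    refine ind _ (fun b α => ?_) (fun P Q hP hQ => ?_)
    · rw [← mul_assoc, dd_mulOp, add_mul, mul_assoc, ← opMon_add_single _ dd_comm, hadd, hL1, hL1,
        hL1, opMon_add_single _ hd, ← mul_assoc, ← mul_assoc, hφ, add_mul]
    · rw [mul_add, hadd, hadd, hP, hQ, mul_add]
  have hone : L 1 = 1 := by simpa [opMon_zero] using hL1 1 0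
  have hA : ∀ a, L (DiffOp.mulOp a) = φ a := fun a => by simpa [hone] using hmulOp a 1
  have hmul : ∀ P Q, L (P * Q) = L P * L Q := by
    refine ind _ (fun a α Q => ?_) (fun P P' hP hP' Q => ?_)
    · rw [mul_assoc, hmulOp, hmulOp, mul_assoc]
      congr 1
      induction α using opMon_induction with
      | h0 => rw [opMon_zero, hone, one_mul, one_mul]
      | h1 α i ih => rw [opMon_add_single _ dd_comm, mul_assoc, hdd, hdd, ih, mul_assoc]
    · rw [add_mul, hadd, hadd, hP, hP', add_mul]
  refine ⟨
    { toFun := L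
      map_one' := hone
      map_mul' := hmul
      map_zero' := by simpa using hA 0
      map_add' := hadd
      commutes' := fun c => ?_ }, hA, fun i => by simpa [hone] using hdd i 1⟩
  have := hA (algebraMap k A c)
  rwa [AlgHom.commutes, AlgHom.commutes] at this

/-- `𝒟(A, k)` is generated by `A` and `∂_1, …, ∂_n`. -/
theorem DiffOp.gen_induction [CharZero k] {p : DiffOp k A → Prop}
    (hA : ∀ a, p (DiffOp.mulOp a)) (hdd : ∀ i, p (dd k A i))
    (hadd : ∀ P Q, p P → p Q → p (P + Q)) (hmul : ∀ P Q, p P → p Q → p (P * Q))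
    (P : DiffOp k A) : p P := by
  obtain ⟨c, rfl⟩ := opExpand_dd_surjective P
  induction c using Finsupp.induction_linear with
  | zero => rw [map_zero]; simpa using hA 0
  | add c c' h h' => rw [map_add]; exact hadd _ _ h h'
  | single α a =>
    rw [opExpand_single]
    refine hmul _ _ (hA a) ?_
    induction α using opMon_induction with
    | h0 => rw [opMon_zero]; simpa using hA 1
    | h1 α i ih => rw [opMon_add_single _ dd_comm]; exact hmul _ _ (hdd i) ih

/-- The algebra map `𝒟(A, k) → E` determined by its restriction `φ` to `A` and by the images `d_i`
of the `∂_i`. -/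
def DiffOp.lift [CharZero k] {E : Type w} [Ring E] [Algebra k E] (φ : A →ₐ[k] E)
    (d : Fin n → E) (hd : ∀ i j, Commute (d i) (d j))
    (hφ : ∀ i a, d i * φ a = φ a * d i + φ (pd (k := k) i a)) : DiffOp k A →ₐ[k] E :=
  (DiffOp.exists_lift φ d hd hφ).choose

theorem DiffOp.lift_mulOp [CharZero k] {E : Type w} [Ring E] [Algebra k E] (φ : A →ₐ[k] E)
    (d : Fin n → E) (hd : ∀ i j, Commute (d i) (d j))
    (hφ : ∀ i a, d i * φ a = φ a * d i + φ (pd (k := k) i a)) (a : A) :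
    DiffOp.lift φ d hd hφ (DiffOp.mulOp a) = φ a :=
  (DiffOp.exists_lift φ d hd hφ).choose_spec.1 a

theorem DiffOp.lift_dd [CharZero k] {E : Type w} [Ring E] [Algebra k E] (φ : A →ₐ[k] E)
    (d : Fin n → E) (hd : ∀ i j, Commute (d i) (d j))
    (hφ : ∀ i a, d i * φ a = φ a * d i + φ (pd (k := k) i a)) (i : Fin n) :
    DiffOp.lift φ d hd hφ (dd k A i) = d i :=
  (DiffOp.exists_lift φ d hd hφ).choose_spec.2 i

end PBW

/-! ### Polynomials and formal power series -/

section Instances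

variable (k : Type u) [Field k] (n : ℕ)

/-- The polynomial ring `R = k[x_1, …, x_n]`. -/
abbrev PolyR : Type u := MvPolynomial (Fin n) k

/-- The formal power series ring `R̂ = k[[x_1, …, x_n]]`. -/
abbrev PowR : Type u := MvPowerSeries (Fin n) k

theorem coordMon_poly (β : Fin n →₀ ℕ) :
    coordMon (MvPolynomial.X : Fin n → PolyR k n) β = MvPolynomial.monomial β 1 := by
  rw [MvPolynomial.monomial_eq, map_one, one_mul]
  rfl

theorem coordMon_pow (β : Fin n →₀ ℕ) :
    coordMon (MvPowerSeries.X : Fin n → PowR k n) β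
      = ((MvPolynomial.monomial β (1 : k) : PolyR k n) : PowR k n) := by
  rw [← coordMon_poly]
  induction β using opMon_induction with
  | h0 => rw [coordMon_zero, coordMon_zero, MvPolynomial.coe_one]
  | h1 β i ih =>
    rw [coordMon_add_single, coordMon_add_single, MvPolynomial.coe_mul, MvPolynomial.coe_X, ih]

instance polyCoordinates : Coordinates k (PolyR k n) n where
  x := MvPolynomial.X
  pd := MvPolynomial.pderiv
  pd_comm i j a := by
    ext m
    simp only [MvPolynomial.coeff_pderiv, Finsupp.add_apply]
    rw [add_right_comm]
    by_cases h : i = j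
    · subst h; rfl
    · rw [Finsupp.single_eq_of_ne h, Finsupp.single_eq_of_ne' h]
      push_cast
      ring
  pd_x i j := by
    rw [MvPolynomial.pderiv_X, Pi.single_apply]
    simp only [eq_comm]
  ext_mon P _ h := by
    refine (MvPolynomial.basisMonomials (Fin n) k).ext fun β => ?_
    simpa [coordMon_poly] using h β

/-- Power series of order at least `N`. -/
def HasOrder (N : ℕ) (f : PowR k n) : Prop := ∀ β : Fin n →₀ ℕ, β.degree < N →
  MvPowerSeries.coeff β f = 0

variable {k n}

theorem HasOrder.mul_left {N : ℕ} {f : PowR k n} (hf : HasOrder k n N f) (g : PowR k n) :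
    HasOrder k n N (g * f) := by
  classical
  intro β hβ
  rw [MvPowerSeries.coeff_mul]
  refine Finset.sum_eq_zero fun p hp => ?_
  rw [hf p.2, mul_zero]
  have := congrArg Finsupp.degree (Finset.HasAntidiagonal.mem_antidiagonal.mp hp)
  rw [map_add] at this
  omega

theorem HasOrder.sum {ι : Type*} (s : Finset ι) {N : ℕ} {f : ι → PowR k n}
    (hf : ∀ i ∈ s, HasOrder k n N (f i)) : HasOrder k n N (∑ i ∈ s, f i) := by
  intro β hβ
  rw [map_sum]
  exact Finset.sum_eq_zero fun i hi => hf i hi β hβ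

theorem HasOrder.add {N : ℕ} {f g : PowR k n} (hf : HasOrder k n N f) (hg : HasOrder k n N g) :
    HasOrder k n N (f + g) := by
  intro β hβ
  rw [map_add, hf β hβ, hg β hβ, add_zero]

theorem coeff_X_mul_pow (i : Fin n) (f : PowR k n) (β : Fin n →₀ ℕ) :
    MvPowerSeries.coeff β (MvPowerSeries.X i * f)
      = if β i = 0 then 0 else MvPowerSeries.coeff (β - Finsupp.single i 1) f := by
  classical
  rw [MvPowerSeries.X, MvPowerSeries.coeff_monomial_mul, one_mul]
  by_cases h : β i = 0
  · rw [if_pos h, if_neg]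
    intro hle
    have := hle i
    simp [h] at this
  · rw [if_neg h, if_pos]
    exact Finsupp.single_le_iff.mpr (by omega)

theorem HasOrder.X_mul {N : ℕ} {f : PowR k n} (hf : HasOrder k n N f) (i : Fin n) :
    HasOrder k n (N + 1) (MvPowerSeries.X i * f) := by
  intro β hβ
  rw [coeff_X_mul_pow]
  split_ifs with h
  · rfl
  · apply hf
    have e : β - Finsupp.single i 1 + Finsupp.single i 1 = β :=
      tsub_add_cancel_of_le (Finsupp.single_le_iff.mpr (by omega))
    have := congrArg Finsupp.degree e
    rw [map_add, Finsupp.degree_single] at this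
    omega

theorem HasOrder.exists_sum {N : ℕ} {f : PowR k n} (hf : HasOrder k n (N + 1) f) :
    ∃ g : Fin n → PowR k n, (∀ i, HasOrder k n N (g i)) ∧ f = ∑ i, MvPowerSeries.X i * g i := by
  classical
  let pick : (Fin n →₀ ℕ) → Fin n → Prop := fun β i => β i ≠ 0 ∧ ∀ j < i, β j = 0
  obtain ⟨g, hg⟩ : ∃ g : Fin n → PowR k n, ∀ i γ, MvPowerSeries.coeff γ (g i)
      = if pick (γ + Finsupp.single i 1) i then
        MvPowerSeries.coeff (γ + Finsupp.single i 1) f else 0 :=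
    ⟨fun i γ => if pick (γ + Finsupp.single i 1) i then
      MvPowerSeries.coeff (γ + Finsupp.single i 1) f else 0, fun _ _ => rfl⟩
  refine ⟨g, fun i γ hγ => ?_, ?_⟩
  · rw [hg]
    split_ifs
    · apply hf; rw [map_add, Finsupp.degree_single]; omega
    · rfl
  · ext β
    rw [map_sum]
    have e : ∀ i, MvPowerSeries.coeff β (MvPowerSeries.X i * g i)
        = if pick β i then MvPowerSeries.coeff β f else 0 := by
      intro i
      rw [coeff_X_mul_pow]
      by_cases h : β i = 0
      · rw [if_pos h, if_neg (fun hp => hp.1 h)]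
      · rw [if_neg h, hg, tsub_add_cancel_of_le (Finsupp.single_le_iff.mpr (by omega))]
    simp only [e]
    by_cases hβ : β = 0
    · subst hβ
      rw [hf 0 (by simp)]
      simp
    · have hne : (Finset.univ.filter fun i => β i ≠ 0).Nonempty := by
        obtain ⟨i, hi⟩ := Finsupp.ne_iff.mp hβ
        exact ⟨i, by simpa using hi⟩
      obtain ⟨i₀, hmem, hle⟩ : ∃ i₀ ∈ Finset.univ.filter fun i => β i ≠ 0,
          ∀ j ∈ Finset.univ.filter fun i => β i ≠ 0, i₀ ≤ j :=
        ⟨_, Finset.min'_mem _ hne, fun j hj => Finset.min'_le _ j hj⟩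
      have hpick : pick β i₀ := by
        refine ⟨by simpa using hmem, fun j hj => ?_⟩
        by_contra hj0
        exact absurd (hle j (by simpa using hj0)) (not_le.mpr hj)
      rw [Finset.sum_eq_single i₀, if_pos hpick]
      · intro j _ hj
        rw [if_neg]
        intro hp
        rcases lt_or_gt_of_ne hj with h | h
        · exact hp.1 (hpick.2 j h)
        · exact hpick.1 (hp.2 i₀ h)
      · intro h; exact absurd (Finset.mem_univ _) h

theorem IsDiffOpLT.hasOrder {m : ℕ} {P : Module.End k (PowR k n)}
    (hP : IsDiffOpLT k (PowR k n) m P) (N : ℕ) (f : PowR k n) (hf : HasOrder k n (N + m) f) :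
    HasOrder k n N (P f) := by
  induction m generalizing P N f with
  | zero =>
    simp only [IsDiffOpLT] at hP
    subst hP
    intro β _
    simp
  | succ m ih =>
    induction N generalizing f with
    | zero => intro β h; exact absurd h (by omega)
    | succ N ihN =>
      obtain ⟨g, hg, rfl⟩ := HasOrder.exists_sum (N := N + 1 + m) hf
      rw [map_sum]
      refine HasOrder.sum _ fun i _ => ?_
      have h1 := ih (hP (MvPowerSeries.X i)) (N + 1) (g i) (hg i)
      have h2 := (ihN (g i) (by
        have := hg i
        rwa [show N + 1 + m = N + (m + 1) by omega] at this)).X_mul i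
      have e : P (MvPowerSeries.X i * g i) = (P * Algebra.lmul k (PowR k n) (MvPowerSeries.X i)
          - Algebra.lmul k (PowR k n) (MvPowerSeries.X i) * P) (g i)
          + MvPowerSeries.X i * P (g i) := by simp
      rw [e]
      exact h1.add h2

variable (k n)

instance powCoordinates : Coordinates k (PowR k n) n where
  x := MvPowerSeries.X
  pd := MvPowerSeries.pderiv k
  pd_comm i j a := by
    ext m
    simp only [MvPowerSeries.coeff_pderiv, Finsupp.add_apply]
    rw [add_right_comm]
    by_cases h : i = j
    · subst h; rfl
    · rw [Finsupp.single_eq_of_ne h, Finsupp.single_eq_of_ne' h]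
      push_cast
      ring
  pd_x i j := by
    rw [MvPowerSeries.pderiv_X, Pi.single_apply]
    simp only [eq_comm]
  ext_mon P hP h := by
    obtain ⟨m, hm⟩ := hP
    have hpoly : ∀ q : PolyR k n, P (q : PowR k n) = 0 := by
      intro q
      induction q using MvPolynomial.induction_on' with
      | monomial β a =>
        have := h β
        rw [coordMon_pow] at this
        have e : ((MvPolynomial.monomial β a : PolyR k n) : PowR k n)
            = a • ((MvPolynomial.monomial β (1 : k) : PolyR k n) : PowR k n) := by
          rw [← mul_one a, ← smul_eq_mul, ← MvPolynomial.smul_monomial]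
          ext; simp
        rw [e, map_smul, this, smul_zero]
      | add p q hp hq => rw [MvPolynomial.coe_add, map_add, hp, hq, add_zero]
    ext f β
    have hord : HasOrder k n (β.degree + 1 + m)
        (f - (MvPowerSeries.truncTotal (β.degree + 1 + m) f : PolyR k n)) := by
      intro γ hγ
      rw [map_sub, MvPolynomial.coeff_coe, MvPowerSeries.coeff_truncTotal _ hγ, sub_self]
    have := hm.hasOrder _ _ hord β (by omega)
    rw [map_sub, hpoly, sub_zero] at this
    simpa using this

end Instances

/-! ### Transposition -/

/-- The transpose `N^τ` of a left `𝒟(A, k)`-module `N`: the same additive group with the right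
action `x · δ = τ(δ) x`, i.e. a module over the opposite ring (see the instance below). -/
def Transpose (_k : Type u) (_A : Type v) (N : Type w) : Type w := N

section Transposition

open Coordinates

variable (k : Type u) [Field k] [CharZero k] (A : Type v) [CommRing A] [Algebra k A] {n : ℕ}
  [Coordinates k A n]

/-- The standard transposition, as an algebra map from `𝒟(A, k)` to its opposite: it fixes `A` and
sends `∂_i` to `-∂_i`. -/
def transposition : DiffOp k A →ₐ[k] (DiffOp k A)ᵐᵒᵖ :=
  DiffOp.lift ((DiffOp.mulOp (k := k) (A := A)).toOpposite fun a b => by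
      rw [commute_iff_eq, ← map_mul, ← map_mul, mul_comm])
    (fun i => op (-dd k A i))
    (fun i j => by
      rw [commute_iff_eq, ← op_mul, ← op_mul, neg_mul_neg, neg_mul_neg, (dd_comm i j).eq])
    (fun i a => by
      show op (-dd k A i) * op (DiffOp.mulOp a)
        = op (DiffOp.mulOp a) * op (-dd k A i) + op (DiffOp.mulOp (pd (k := k) i a))
      rw [← op_mul, ← op_mul, ← op_add, neg_mul, mul_neg, dd_mulOp, neg_add, neg_add_cancel_right])

/-- `τ(δ)` -/
def tau (δ : DiffOp k A) : DiffOp k A := unop (transposition k A δ)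

/-- `τ(f ∂^α) = (-1)^{|α|} ∂^α f` -/
theorem tau_mulOp_mul_opMon (f : A) (α : Fin n →₀ ℕ) :
    tau k A (DiffOp.mulOp f * opMon (dd k A) α)
      = (-1) ^ α.degree * opMon (dd k A) α * DiffOp.mulOp f := by
  rw [tau, map_mul, unop_mul, transposition, DiffOp.lift_mulOp]
  congr 1
  induction α using opMon_induction with
  | h0 => simp [opMon_zero]
  | h1 α i ih =>
    rw [opMon_add_single _ dd_comm, map_mul, unop_mul, ih, DiffOp.lift_dd, unop_op, map_add,
      Finsupp.degree_single, pow_succ, (opMon_dd_commute α i).eq]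
    noncomm_ring

instance (N : Type w) [AddCommGroup N] : AddCommGroup (Transpose k A N) :=
  inferInstanceAs (AddCommGroup N)

instance (N : Type w) [AddCommGroup N] [Module k N] : Module k (Transpose k A N) :=
  inferInstanceAs (Module k N)

/-- The identity `N → N^τ`. -/
def Transpose.of {N : Type w} [AddCommGroup N] [Module k N] : N ≃ₗ[k] Transpose k A N :=
  LinearEquiv.refl k N

instance (N : Type w) [AddCommGroup N] [Module k N] [Module (DiffOp k A) N] :
    Module (DiffOp k A)ᵐᵒᵖ (Transpose k A N) where
  smul p y := Transpose.of k A (tau k A (unop p) • (Transpose.of k A).symm y)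
  one_smul y := by
    show tau k A (1 : DiffOp k A) • (Transpose.of k A).symm y = _
    rw [tau, map_one, unop_one, one_smul]
    rfl
  mul_smul p q y := by
    show tau k A (unop q * unop p) • (Transpose.of k A).symm y
      = tau k A (unop p) • tau k A (unop q) • (Transpose.of k A).symm y
    rw [← mul_smul, tau, map_mul, unop_mul]
    rfl
  smul_zero p := smul_zero (M := DiffOp k A) (A := N) _
  smul_add p := smul_add (M := DiffOp k A) (A := N) _
  add_smul p q y := by
    show tau k A (unop p + unop q) • (Transpose.of k A).symm y
      = tau k A (unop p) • (Transpose.of k A).symm y + tau k A (unop q) • (Transpose.of k A).symm y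
    rw [← add_smul, tau, map_add, unop_add]
    rfl
  zero_smul y := by
    show tau k A (0 : DiffOp k A) • (Transpose.of k A).symm y = (0 : N)
    rw [tau, map_zero, unop_zero, zero_smul]

theorem Transpose.op_smul_of {N : Type w} [AddCommGroup N] [Module k N] [Module (DiffOp k A) N]
    (δ : DiffOp k A) (y : N) :
    op δ • Transpose.of k A y = Transpose.of k A (tau k A δ • y) := rfl

end Transposition

/-! ### The ring map `𝒟 → 𝒟̂` and the completion `M̂ = R̂ ⊗_R M` -/

section Completion

variable (k : Type u) [Field k] [CharZero k] (n : ℕ)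

/-- The inclusion `R → R̂`. -/
def polyToPow : PolyR k n →ₐ[k] PowR k n := MvPolynomial.coeToMvPowerSeries.algHom k

theorem polyToPow_eq_algebraMap (r : PolyR k n) :
    polyToPow k n r = algebraMap (PolyR k n) (PowR k n) r := rfl

theorem pd_polyToPow (i : Fin n) (r : PolyR k n) :
    Coordinates.pd (k := k) i (polyToPow k n r)
      = polyToPow k n (Coordinates.pd (k := k) i r) := by
  have h := MvPowerSeries.pderiv_coe (i := i) r
  have e : ∀ q : PolyR k n, polyToPow k n q = (q : PowR k n) := fun q => by simp [polyToPow]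
  rw [e, e]
  exact h

/-- The inclusion of `𝒟 = 𝒟(R, k)` in `𝒟̂ = 𝒟(R̂, k)`, which extends `R → R̂` and sends `∂_i` to
`∂_i`. -/
def extendOp : DiffOp k (PolyR k n) →ₐ[k] DiffOp k (PowR k n) :=
  DiffOp.lift (DiffOp.mulOp.comp (polyToPow k n)) (dd k (PowR k n)) dd_comm fun i a => by
    simp only [AlgHom.comp_apply]
    rw [dd_mulOp, pd_polyToPow]

/-- `extendOp` extends operators from `R` to `R̂`. -/
theorem extendOp_smul_polyToPow (δ : DiffOp k (PolyR k n)) (r : PolyR k n) :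
    extendOp k n δ • polyToPow k n r = polyToPow k n (δ • r) := by
  induction δ using DiffOp.gen_induction generalizing r with
  | hA a => rw [extendOp, DiffOp.lift_mulOp]; simp
  | hdd i => rw [extendOp, DiffOp.lift_dd]; exact pd_polyToPow k n i r
  | hadd P Q hP hQ => rw [map_add, add_smul, add_smul, hP, hQ, map_add]
  | hmul P Q hP hQ => rw [map_mul, mul_smul, mul_smul, hQ, hP]

theorem tau_extendOp (δ : DiffOp k (PolyR k n)) :
    tau k (PowR k n) (extendOp k n δ) = extendOp k n (tau k (PolyR k n) δ) := by
  induction δ using DiffOp.gen_induction with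
  | hA a =>
    have e : ∀ b : PolyR k n, extendOp k n (DiffOp.mulOp b) = DiffOp.mulOp (polyToPow k n b) :=
      DiffOp.lift_mulOp _ _ _ _
    rw [e, tau, tau, transposition, DiffOp.lift_mulOp, transposition, DiffOp.lift_mulOp]
    exact (e a).symm
  | hdd i =>
    have e : extendOp k n (dd k (PolyR k n) i) = dd k (PowR k n) i := DiffOp.lift_dd _ _ _ _ i
    rw [e, tau, tau, transposition, DiffOp.lift_dd, transposition, DiffOp.lift_dd, unop_op,
      unop_op, map_neg, e]
  | hadd P Q hP hQ => simp only [tau, map_add, unop_add] at *; rw [hP, hQ]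
  | hmul P Q hP hQ => simp only [tau, map_mul, unop_mul] at *; rw [hP, hQ]

variable (M : Type v) [AddCommGroup M] [Module (PolyR k n) M]

/-- The completion `M̂ = R̂ ⊗_R M`. -/
def Completion : Type (max u v) := PowR k n ⊗[PolyR k n] M

instance : AddCommGroup (Completion k n M) :=
  inferInstanceAs (AddCommGroup (PowR k n ⊗[PolyR k n] M))

instance : Module (PowR k n) (Completion k n M) :=
  inferInstanceAs (Module (PowR k n) (PowR k n ⊗[PolyR k n] M))

instance : Module k (Completion k n M) :=
  inferInstanceAs (Module k (PowR k n ⊗[PolyR k n] M))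

instance : IsScalarTower k (PowR k n) (Completion k n M) :=
  inferInstanceAs (IsScalarTower k (PowR k n) (PowR k n ⊗[PolyR k n] M))

variable {M}

variable [Module (DiffOp k (PolyR k n)) M] [IsScalarTower (PolyR k n) (DiffOp k (PolyR k n)) M]

theorem mulOp_smul_eq (r : PolyR k n) (m : M) :
    (DiffOp.mulOp r : DiffOp k (PolyR k n)) • m = r • m := by
  have := smul_assoc r (1 : DiffOp k (PolyR k n)) m
  rwa [DiffOp.smul_def, mul_one, one_smul] at this

theorem dd_smul_smul (i : Fin n) (r : PolyR k n) (m : M) :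
    dd k (PolyR k n) i • r • m
      = r • dd k (PolyR k n) i • m + (Coordinates.pd (k := k) i r) • m := by
  rw [← mulOp_smul_eq, ← mul_smul, dd_mulOp, add_smul, mul_smul, mulOp_smul_eq, mulOp_smul_eq]

theorem partialTensor_aux (i : Fin n) (r : PolyR k n) (s : PowR k n) (m : M) :
    (Coordinates.pd (k := k) i (r • s)) ⊗ₜ[PolyR k n] m
        + (r • s) ⊗ₜ[PolyR k n] (dd k (PolyR k n) i • m)
      = (Coordinates.pd (k := k) i s) ⊗ₜ[PolyR k n] (r • m)
        + s ⊗ₜ[PolyR k n] (dd k (PolyR k n) i • r • m) := by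
  have e : Coordinates.pd (k := k) i (r • s)
      = r • Coordinates.pd (k := k) i s + (Coordinates.pd (k := k) i r) • s := by
    rw [Algebra.smul_def r, Algebra.smul_def r, Algebra.smul_def _ s, ← polyToPow_eq_algebraMap,
      Derivation.leibniz, pd_polyToPow, smul_eq_mul, smul_eq_mul,
      polyToPow_eq_algebraMap, polyToPow_eq_algebraMap, mul_comm s]
  rw [e, dd_smul_smul, TensorProduct.tmul_add, TensorProduct.add_tmul, TensorProduct.smul_tmul,
    TensorProduct.smul_tmul, TensorProduct.smul_tmul]
  abel

/-- The additive map `s ⊗ m ↦ ∂_i(s) ⊗ m + s ⊗ ∂_i m` -/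
def partialTensorHom (i : Fin n) :
    PowR k n ⊗[PolyR k n] M →+ PowR k n ⊗[PolyR k n] M :=
  TensorProduct.liftAddHom
    (AddMonoidHom.mk' (fun s : PowR k n => AddMonoidHom.mk' (fun m : M =>
        (Coordinates.pd (k := k) i s) ⊗ₜ[PolyR k n] m
          + s ⊗ₜ[PolyR k n] (dd k (PolyR k n) i • m)) (fun m m' => by
        simp only [smul_add, TensorProduct.tmul_add]; abel))
      (fun s s' => by
        ext m
        simp only [map_add, TensorProduct.add_tmul, AddMonoidHom.mk'_apply,
          AddMonoidHom.add_apply]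
        abel))
    (fun r s m => partialTensor_aux k n i r s m)

theorem partialTensorHom_tmul (i : Fin n) (s : PowR k n) (m : M) :
    partialTensorHom k n i (s ⊗ₜ[PolyR k n] m) = (Coordinates.pd (k := k) i s) ⊗ₜ[PolyR k n] m
      + s ⊗ₜ[PolyR k n] (dd k (PolyR k n) i • m) := rfl

theorem partialTensorHom_leibniz (i : Fin n) (s : PowR k n) (t : PowR k n ⊗[PolyR k n] M) :
    partialTensorHom k n i (s • t)
      = s • partialTensorHom k n i t + (Coordinates.pd (k := k) i s) • t := by
  induction t using TensorProduct.induction_on with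
  | zero => simp
  | add a b ha hb => rw [smul_add, map_add, ha, hb, map_add, smul_add, smul_add]; abel
  | tmul s' m =>
    rw [TensorProduct.smul_tmul', partialTensorHom_tmul, partialTensorHom_tmul, smul_add,
      smul_eq_mul, Derivation.leibniz, TensorProduct.add_tmul, TensorProduct.smul_tmul',
      TensorProduct.smul_tmul', TensorProduct.smul_tmul', smul_eq_mul, smul_eq_mul, smul_eq_mul,
      smul_eq_mul, mul_comm s' (Coordinates.pd (k := k) i s)]
    abel

/-- The action of `∂_i` on `M̂`: `∂_i (s ⊗ m) = ∂_i(s) ⊗ m + s ⊗ ∂_i m`. -/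
def partialTensor (i : Fin n) : Module.End k (PowR k n ⊗[PolyR k n] M) where
  toFun := partialTensorHom k n i
  map_add' := map_add _
  map_smul' c t := by
    have h := partialTensorHom_leibniz k n i (algebraMap k _ c) t
    rwa [Derivation.map_algebraMap, zero_smul, add_zero, algebraMap_smul, algebraMap_smul] at h

theorem partialTensor_commute (i j : Fin n) :
    Commute (partialTensor k n i : Module.End k (PowR k n ⊗[PolyR k n] M))
      (partialTensor k n j) := by
  refine LinearMap.ext fun t => ?_
  show partialTensorHom k n i (partialTensorHom k n j t)
    = partialTensorHom k n j (partialTensorHom k n i t)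
  induction t using TensorProduct.induction_on with
  | zero => simp
  | add a b ha hb => rw [map_add, map_add, map_add, map_add, ha, hb]
  | tmul s m =>
    simp only [partialTensorHom_tmul, map_add]
    rw [Coordinates.pd_comm i j, ← mul_smul, ← mul_smul, (dd_comm i j).eq]
    abel

variable (M) in
/-- The action of `𝒟̂` on `M̂ = R̂ ⊗_R M`: it extends the action of `R̂`, and `∂_i` acts by
`partialTensor`. -/
def completionAction : DiffOp k (PowR k n) →ₐ[k] Module.End k (PowR k n ⊗[PolyR k n] M) :=
  DiffOp.lift (Algebra.lsmul k k (PowR k n ⊗[PolyR k n] M)) (partialTensor k n)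
    (partialTensor_commute k n) fun i s =>
      LinearMap.ext fun t => partialTensorHom_leibniz k n i s t

instance : Module (DiffOp k (PowR k n)) (Completion k n M) :=
  Module.compHom (PowR k n ⊗[PolyR k n] M) (completionAction k n M).toRingHom

instance : IsScalarTower k (DiffOp k (PowR k n)) (Completion k n M) :=
  ⟨fun c P t => by
    show completionAction k n M (c • P) t = c • completionAction k n M P t
    rw [map_smul]; rfl⟩

/-- The map `κ : M → M̂`, `κ(m) = 1 ⊗ m`. -/
def kappa (m : M) : Completion k n M := (1 : PowR k n) ⊗ₜ[PolyR k n] m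

theorem kappa_add (m m' : M) : kappa k n (m + m') = kappa k n m + kappa k n m' :=
  TensorProduct.tmul_add _ _ _

/-- `κ` is `𝒟`-linear. -/
theorem kappa_smul (δ : DiffOp k (PolyR k n)) (m : M) :
    kappa k n (δ • m) = extendOp k n δ • kappa k n m := by
  show kappa k n (δ • m) = completionAction k n M (extendOp k n δ) (kappa k n m)
  induction δ using DiffOp.gen_induction generalizing m with
  | hA a =>
    rw [extendOp, DiffOp.lift_mulOp, completionAction, AlgHom.comp_apply, DiffOp.lift_mulOp,
      mulOp_smul_eq]
    show (1 : PowR k n) ⊗ₜ[PolyR k n] (a • m) = polyToPow k n a • ((1 : PowR k n) ⊗ₜ m)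
    rw [TensorProduct.smul_tmul', polyToPow_eq_algebraMap, algebraMap_smul,
      TensorProduct.smul_tmul]
  | hdd i =>
    rw [extendOp, DiffOp.lift_dd, completionAction, DiffOp.lift_dd]
    show _ = partialTensorHom k n i ((1 : PowR k n) ⊗ₜ[PolyR k n] m)
    rw [partialTensorHom_tmul, Derivation.map_one_eq_zero, TensorProduct.zero_tmul, zero_add]
    rfl
  | hadd P Q hP hQ => rw [add_smul, kappa_add, hP, hQ, map_add, map_add]; rfl
  | hmul P Q hP hQ => rw [mul_smul, hP, hQ, map_mul, map_mul]; rfl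

end Completion

/-! ### Subquotients -/

section SubQuot

variable {k : Type u} [Field k] {Y : Type v} [AddCommGroup Y] [Module k Y]
  {Y' : Type w} [AddCommGroup Y'] [Module k Y']

/-- The quotient of the cycles `Z` by the boundaries `B`. -/
abbrev SubQuot (Z B : Submodule k Y) : Type v := Z ⧸ B.submoduleOf Z

/-- The map induced by `f` on subquotients. -/
def SubQuot.map {Z B : Submodule k Y} {Z' B' : Submodule k Y'} (f : Y →ₗ[k] Y')
    (hZ : ∀ y ∈ Z, f y ∈ Z') (hB : ∀ y ∈ B, f y ∈ B') : SubQuot Z B →ₗ[k] SubQuot Z' B' :=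
  Submodule.mapQ _ _ (f.restrict hZ) fun z hz => hB z.1 hz

end SubQuot

/-! ### The de Rham complex -/

/-- `Ω^i(N)`: one copy of `N` for each `j_1 < ⋯ < j_i`, i.e. for each `i`-element subset `s` of
`{1, …, n}`; the value of `ω` at `s` is the coefficient of `dx_{j_1} ∧ ⋯ ∧ dx_{j_i}`. -/
abbrev DRForm (n i : ℕ) (N : Type w) : Type w := {s : Finset (Fin n) // s.card = i} → N

section DeRham

variable (k : Type u) [Field k] (A : Type v) [CommRing A] [Algebra k A] {n : ℕ}
  [Coordinates k A n] (N : Type w) [AddCommGroup N] [Module k N] [Module (DiffOp k A) N]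
  [IsScalarTower k (DiffOp k A) N]

/-- The differential `d^i : Ω^i(N) → Ω^{i+1}(N)`. The coefficient of `dω` at `t` is the sum over
`s ∈ t` of `± ∂_s` applied to the coefficient of `ω` at `t \ {s}`, where the sign is that of
`dx_s ∧ dx_{t \ {s}} = ± dx_t`. -/
def dRham (i : ℕ) : DRForm n i N →ₗ[k] DRForm n (i + 1) N where
  toFun ω t := ∑ s : {s // s ∈ t.1}, (-1 : ℤ) ^ (t.1.filter (· < s.1)).card •
    dd k A s.1 • ω ⟨t.1.erase s.1, by rw [Finset.card_erase_of_mem s.2, t.2]; rfl⟩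
  map_add' ω η := by
    ext t
    simp only [Pi.add_apply, smul_add, Finset.sum_add_distrib]
  map_smul' c ω := by
    ext t
    simp only [Pi.smul_apply, RingHom.id_apply, Finset.smul_sum]
    refine Finset.sum_congr rfl fun s _ => ?_
    rw [smul_comm (dd k A s.1) c, smul_comm _ c]

/-- The coboundaries in `Ω^i(N)`. -/
def dRhamBoundaries : (i : ℕ) → Submodule k (DRForm n i N)
  | 0 => ⊥
  | i + 1 => LinearMap.range (dRham k A N i)

/-- The de Rham cohomology space `H^i_dR(N)`. -/
abbrev HdR (i : ℕ) : Type w := SubQuot (LinearMap.ker (dRham k A N i)) (dRhamBoundaries k A N i)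

end DeRham

/-! ### Tensor products over noncommutative rings -/

section BalTensor

variable (k : Type u) [Field k] (D : Type v) [Ring D] [Algebra k D]
  (X : Type*) [AddCommGroup X] [Module k X] [Module Dᵐᵒᵖ X]

/-- The relations `xδ ⊗ y = x ⊗ δy`. -/
def balancedRel (N : Type*) [AddCommGroup N] [Module k N] [Module D N] :
    Submodule k (X ⊗[k] N) :=
  Submodule.span k {t | ∃ (x : X) (δ : D) (y : N), t = (op δ • x) ⊗ₜ[k] y - x ⊗ₜ[k] (δ • y)}

/-- The `k`-space `X ⊗_D N` for a right `D`-module `X` and a left `D`-module `N` over a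
`k`-algebra `D`. -/
abbrev BalTensor (N : Type*) [AddCommGroup N] [Module k N] [Module D N] : Type _ :=
  (X ⊗[k] N) ⧸ balancedRel k D X N

variable {k D X}

/-- The class of `x ⊗ y` in `X ⊗_D N`. -/
def BalTensor.tmul {N : Type*} [AddCommGroup N] [Module k N] [Module D N] (x : X) (y : N) :
    BalTensor k D X N := Submodule.Quotient.mk (x ⊗ₜ[k] y)

/-- The map `X ⊗_D N → X' ⊗_{D'} N'` induced by `ψ : X → X'` and `g : N → N'` that are compatible
with a map of `k`-algebras `f : D → D'`. -/
def BalTensor.map {D' : Type*} [Ring D'] [Algebra k D'] (f : D →ₐ[k] D')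
    {X' : Type*} [AddCommGroup X'] [Module k X'] [Module D'ᵐᵒᵖ X']
    {N : Type*} [AddCommGroup N] [Module k N] [Module D N]
    {N' : Type*} [AddCommGroup N'] [Module k N'] [Module D' N']
    (ψ : X →ₗ[k] X') (hψ : ∀ (δ : D) (x : X), ψ (op δ • x) = op (f δ) • ψ x)
    (g : N →ₗ[k] N') (hg : ∀ (δ : D) (y : N), g (δ • y) = f δ • g y) :
    BalTensor k D X N →ₗ[k] BalTensor k D' X' N' :=
  Submodule.mapQ _ _ (TensorProduct.map ψ g) <| Submodule.span_le.mpr <| by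
    rintro _ ⟨x, δ, y, rfl⟩
    refine Submodule.subset_span ⟨ψ x, f δ, g y, ?_⟩
    rw [map_sub, TensorProduct.map_tmul, TensorProduct.map_tmul, hψ, hg]

theorem BalTensor.map_tmul {D' : Type*} [Ring D'] [Algebra k D'] (f : D →ₐ[k] D')
    {X' : Type*} [AddCommGroup X'] [Module k X'] [Module D'ᵐᵒᵖ X']
    {N : Type*} [AddCommGroup N] [Module k N] [Module D N]
    {N' : Type*} [AddCommGroup N'] [Module k N'] [Module D' N']
    (ψ : X →ₗ[k] X') (hψ : ∀ (δ : D) (x : X), ψ (op δ • x) = op (f δ) • ψ x)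
    (g : N →ₗ[k] N') (hg : ∀ (δ : D) (y : N), g (δ • y) = f δ • g y) (x : X) (y : N) :
    BalTensor.map f ψ hψ g hg (BalTensor.tmul x y) = BalTensor.tmul (ψ x) (g y) := rfl

theorem BalTensor.hom_ext {N : Type*} [AddCommGroup N] [Module k N] [Module D N]
    {P : Type*} [AddCommGroup P] [Module k P] {f g : BalTensor k D X N →ₗ[k] P}
    (h : ∀ x y, f (BalTensor.tmul x y) = g (BalTensor.tmul x y)) : f = g :=
  Submodule.linearMap_qext _ (TensorProduct.ext' h)

end BalTensor

/-! ### The canonical free resolution -/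

section FreeResolution

/-- The canonical map from the free module on the set `N` to `N`. -/
abbrev freeCover (D : Type u) [Ring D] (N : Type v) [AddCommGroup N] [Module D N] :
    (N →₀ D) →ₗ[D] N := Finsupp.linearCombination D id

/-- The modules `S_0 = N` and `S_{j+1} = ker(D^{(S_j)} → S_j)`. -/
def syz (D : Type u) [Ring D] (N : Type v) [AddCommGroup N] [Module D N] :
    ℕ → ModuleCat.{max u v} D
  | 0 => ModuleCat.of D (ULift.{u} N)
  | j + 1 => ModuleCat.of D (LinearMap.ker (freeCover D (syz D N j)))

variable (D : Type u) [Ring D] (N : Type v) [AddCommGroup N] [Module D N]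

/-- The term `F_j = D^{(S_j)}` of the canonical free resolution of `N`. -/
abbrev freeRes (j : ℕ) : Type (max u v) := syz D N j →₀ D

/-- The inclusion `S_{j+1} → F_j`. -/
def syzIncl (j : ℕ) : syz D N (j + 1) →ₗ[D] freeRes D N j :=
  (LinearMap.ker (freeCover D (syz D N j))).subtype

/-- The identification `S_0 = N`. -/
def syzZero : syz D N 0 →ₗ[D] N := (ULift.moduleEquiv : ULift.{u} N ≃ₗ[D] N).toLinearMap

/-- The differential `F_{j+1} → S_{j+1} ⊆ F_j`. -/
def freeRes.d (j : ℕ) : freeRes D N (j + 1) →ₗ[D] freeRes D N j :=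
  syzIncl D N j ∘ₗ freeCover D (syz D N (j + 1))

/-- The augmentation `F_0 → N`. -/
def freeRes.aug : freeRes D N 0 →ₗ[D] N := syzZero D N ∘ₗ freeCover D (syz D N 0)

theorem freeCover_surjective : Function.Surjective (freeCover D N) :=
  fun y => ⟨Finsupp.single y 1, by simp [freeCover]⟩

theorem ker_syzZero : LinearMap.ker (syzZero D N) = ⊥ :=
  LinearMap.ker_eq_bot_of_injective (f := syzZero D N) ULift.down_injective

theorem ker_syzIncl (j : ℕ) : LinearMap.ker (syzIncl D N j) = ⊥ :=
  LinearMap.ker_eq_bot_of_injective (f := syzIncl D N j) Subtype.val_injective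

theorem range_syzIncl (j : ℕ) :
    LinearMap.range (syzIncl D N j) = LinearMap.ker (freeCover D (syz D N j)) :=
  Submodule.range_subtype _

/-- `⋯ → F_1 → F_0 → N → 0` is exact at `N`. -/
theorem freeRes.aug_surjective : Function.Surjective (freeRes.aug D N) :=
  fun y => (freeCover_surjective D (syz D N 0) (ULift.up y)).imp fun _ h => congrArg ULift.down h

theorem freeRes.range_d (j : ℕ) :
    LinearMap.range (freeRes.d D N j) = LinearMap.ker (freeCover D (syz D N j)) := by
  rw [freeRes.d, LinearMap.range_comp,
    LinearMap.range_eq_top.mpr (freeCover_surjective D (syz D N (j + 1))), Submodule.map_top,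
    range_syzIncl]

/-- `⋯ → F_1 → F_0 → N → 0` is exact at `F_0`. -/
theorem freeRes.exact_zero :
    LinearMap.range (freeRes.d D N 0) = LinearMap.ker (freeRes.aug D N) := by
  rw [freeRes.range_d, freeRes.aug, LinearMap.ker_comp, ker_syzZero]
  rfl

/-- `⋯ → F_1 → F_0 → N → 0` is exact at `F_{j+1}`. -/
theorem freeRes.exact_succ (j : ℕ) :
    LinearMap.range (freeRes.d D N (j + 1)) = LinearMap.ker (freeRes.d D N j) := by
  rw [freeRes.range_d, freeRes.d, LinearMap.ker_comp, ker_syzIncl]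
  rfl

variable {D N} {D' : Type w} [Ring D'] {N' : Type*} [AddCommGroup N'] [Module D' N']

/-- The map of free modules induced by a ring map and a map of bases. -/
def freeMap (f : D →+* D') {S T : Type*} (g : S → T) : (S →₀ D) →ₛₗ[f] (T →₀ D') where
  toFun v := (v.mapRange f (map_zero f)).mapDomain g
  map_add' v v' := by
    rw [Finsupp.mapRange_add (map_add f), Finsupp.mapDomain_add]
  map_smul' a v := by
    rw [← Finsupp.mapDomain_smul]
    congr 1
    ext s
    simp

theorem freeMap_single (f : D →+* D') {S T : Type*} (g : S → T) (s : S) (a : D) :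
    freeMap f g (Finsupp.single s a) = Finsupp.single (g s) (f a) := by
  simp [freeMap]

theorem freeCover_freeMap (f : D →+* D') (φ : N →ₛₗ[f] N') (v : N →₀ D) :
    freeCover D' N' (freeMap f φ v) = φ (freeCover D N v) := by
  induction v using Finsupp.induction_linear with
  | zero => simp
  | add v v' h h' => rw [map_add, map_add, h, h', map_add, map_add]
  | single s a => rw [freeMap_single]; simp [freeCover]

/-- The maps `S_j(N) → S_j(N')` induced by a map `N → N'` over a ring map `D → D'`. -/
def syzMap (f : D →+* D') (φ : N →ₛₗ[f] N') : (j : ℕ) → syz D N j →ₛₗ[f] syz D' N' j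
  | 0 =>
    { toFun := fun y => ULift.up (φ y.down)
      map_add' := fun y y' => congrArg ULift.up (map_add φ y.down y'.down)
      map_smul' := fun a y => congrArg ULift.up (map_smulₛₗ φ a y.down) }
  | j + 1 =>
    { toFun := fun v => ⟨freeMap f (syzMap f φ j) v.1, by
        rw [LinearMap.mem_ker, freeCover_freeMap, LinearMap.mem_ker.mp v.2, map_zero]⟩
      map_add' := fun v v' => Subtype.ext (map_add (freeMap f (syzMap f φ j)) v.1 v'.1)
      map_smul' := fun a v => Subtype.ext (map_smulₛₗ (freeMap f (syzMap f φ j)) a v.1) }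

/-- The map of free resolutions induced by a map `N → N'` over a ring map `D → D'`. -/
def freeResMap (f : D →+* D') (φ : N →ₛₗ[f] N') (j : ℕ) :
    freeRes D N j →ₛₗ[f] freeRes D' N' j := freeMap f (syzMap f φ j)

theorem freeResMap_d (f : D →+* D') (φ : N →ₛₗ[f] N') (j : ℕ) (v : freeRes D N (j + 1)) :
    freeResMap f φ j (freeRes.d D N j v) = freeRes.d D' N' j (freeResMap f φ (j + 1) v) := by
  have h := freeCover_freeMap f (syzMap f φ (j + 1)) v
  show _ = (freeCover D' (syz D' N' (j + 1)) (freeMap f (syzMap f φ (j + 1)) v)).1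
  rw [h]
  rfl

theorem freeResMap_aug (f : D →+* D') (φ : N →ₛₗ[f] N') (v : freeRes D N 0) :
    freeRes.aug D' N' (freeResMap f φ 0 v) = φ (freeRes.aug D N v) :=
  congrArg ULift.down (freeCover_freeMap f (syzMap f φ 0) v)

end FreeResolution

/-! ### Tor -/

section Tor

variable (k : Type u) [Field k] (D : Type v) [Ring D] [Algebra k D]
  (X : Type*) [AddCommGroup X] [Module k X] [Module Dᵐᵒᵖ X]
  (N : Type w) [AddCommGroup N] [Module D N]

/-- The differential `X ⊗_D F_{j+1} → X ⊗_D F_j`. -/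
def torD (j : ℕ) : BalTensor k D X (freeRes D N (j + 1)) →ₗ[k] BalTensor k D X (freeRes D N j) :=
  BalTensor.map (AlgHom.id k D) LinearMap.id (fun _ _ => rfl)
    ((freeRes.d D N j).restrictScalars k) (fun δ y => map_smul (freeRes.d D N j) δ y)

/-- The cycles in `X ⊗_D F_j`. -/
def torCycles : (j : ℕ) → Submodule k (BalTensor k D X (freeRes D N j))
  | 0 => ⊤
  | j + 1 => LinearMap.ker (torD k D X N j)

/-- `Tor_j^D(X, N)`, the `j`-th homology of `X ⊗_D F_•` for the canonical free resolution `F_•` of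
the left `D`-module `N`. -/
abbrev TorSpace (j : ℕ) : Type _ :=
  SubQuot (torCycles k D X N j) (LinearMap.range (torD k D X N j))

variable {k D X N} {D' : Type*} [Ring D'] [Algebra k D']
  {X' : Type*} [AddCommGroup X'] [Module k X'] [Module D'ᵐᵒᵖ X']
  {N' : Type*} [AddCommGroup N'] [Module D' N']

/-- The map `X ⊗_D F_j(N) → X' ⊗_{D'} F_j(N')`. -/
def torChainMap (f : D →ₐ[k] D') (ψ : X →ₗ[k] X')
    (hψ : ∀ (δ : D) (x : X), ψ (op δ • x) = op (f δ) • ψ x) (φ : N →ₛₗ[f.toRingHom] N') (j : ℕ) :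
    BalTensor k D X (freeRes D N j) →ₗ[k] BalTensor k D' X' (freeRes D' N' j) :=
  BalTensor.map f ψ hψ
    { toFun := freeResMap f.toRingHom φ j
      map_add' := map_add _
      map_smul' := fun c v => by
        have h := map_smulₛₗ (freeResMap f.toRingHom φ j) (algebraMap k D c) v
        rw [algebraMap_smul] at h
        rw [h]
        show f (algebraMap k D c) • _ = _
        rw [f.commutes, algebraMap_smul]
        rfl }
    (fun δ y => map_smulₛₗ (freeResMap f.toRingHom φ j) δ y)

theorem torChainMap_torD (f : D →ₐ[k] D') (ψ : X →ₗ[k] X')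
    (hψ : ∀ (δ : D) (x : X), ψ (op δ • x) = op (f δ) • ψ x) (φ : N →ₛₗ[f.toRingHom] N') (j : ℕ)
    (t : BalTensor k D X (freeRes D N (j + 1))) :
    torChainMap f ψ hψ φ j (torD k D X N j t)
      = torD k D' X' N' j (torChainMap f ψ hψ φ (j + 1) t) := by
  suffices h : torChainMap f ψ hψ φ j ∘ₗ torD k D X N j
      = torD k D' X' N' j ∘ₗ torChainMap f ψ hψ φ (j + 1) from LinearMap.congr_fun h t
  refine BalTensor.hom_ext fun x y => ?_
  exact congrArg (BalTensor.tmul (ψ x)) (freeResMap_d f.toRingHom φ j y)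

/-- The map `Tor_j^D(X, N) → Tor_j^{D'}(X', N')` induced by `ψ : X → X'` and `φ : N → N'` over a
map of `k`-algebras `f : D → D'`. -/
def torMap (f : D →ₐ[k] D') (ψ : X →ₗ[k] X')
    (hψ : ∀ (δ : D) (x : X), ψ (op δ • x) = op (f δ) • ψ x) (φ : N →ₛₗ[f.toRingHom] N') (j : ℕ) :
    TorSpace k D X N j →ₗ[k] TorSpace k D' X' N' j :=
  SubQuot.map (torChainMap f ψ hψ φ j)
    (by
      cases j with
      | zero => exact fun _ _ => Submodule.mem_top
      | succ j =>
        intro t ht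
        have h0 : torD k D X N j t = 0 := ht
        show torD k D' X' N' j _ = 0
        rw [← torChainMap_torD, h0, map_zero])
    (by
      rintro _ ⟨t, rfl⟩
      exact ⟨_, (torChainMap_torD f ψ hψ φ j t).symm⟩)

end Tor

/-! ### The comparison of de Rham cohomology with Tor -/

section Comparison

variable (k : Type u) [Field k] [CharZero k] (A : Type v) [CommRing A] [Algebra k A] {n : ℕ}
  [Coordinates k A n] (N : Type w) [AddCommGroup N] [Module k N] [Module (DiffOp k A) N]
  [IsScalarTower k (DiffOp k A) N]

/-- Let `F_• → N` be the canonical free resolution. A family of `w_p ∈ Ω^{i+p}(F_p)` is a cycle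
of degree `j = n - i` in the total complex of the double complex
`Ω^•(𝒟) ⊗_𝒟 F_• = Ω^•(F_•)`. (`w_p = 0` for `p > j`, since then `Ω^{i+p} = 0`.) -/
def IsTotalCycle (i j : ℕ) (w : ∀ p, DRForm n (i + p) (freeRes (DiffOp k A) N p)) : Prop :=
  ∀ p, dRham k A (freeRes (DiffOp k A) N p) (i + p) (w p)
    = fun t => (-1 : ℤ) ^ (j + p) • freeRes.d (DiffOp k A) N p (w (p + 1) t)

variable {k A N}

/-- The map `e : H^i_dR(N) → Tor_j(A^τ, N)`, with `i + j = n`, is the one given by the two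
augmentations `Ω^•(N) ← Ω^•(F_•) → A^τ ⊗_𝒟 F_•` of the total complex: `e c = y` if and only if
there is a total cycle `w` whose image `aug(w_0)` in `Ω^i(N)` represents `c` and whose image
`1 ⊗ w_j` in `A^τ ⊗_𝒟 F_j` (where `Ω^n(F_j) = F_j dx_1 ∧ ⋯ ∧ dx_n`) represents `y`. -/
def IsComparison {i j : ℕ} (hij : i + j = n)
    (e : HdR k A N i → TorSpace k (DiffOp k A) (Transpose k A A) N j) : Prop :=
  ∀ c y, e c = y ↔ ∃ w, IsTotalCycle k A N i j w ∧
    (∃ z : LinearMap.ker (dRham k A N i),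
      z.1 = (fun s => freeRes.aug (DiffOp k A) N (w 0 s)) ∧ Submodule.Quotient.mk z = c) ∧
    ∃ z : torCycles k (DiffOp k A) (Transpose k A A) N j,
      z.1 = BalTensor.tmul (Transpose.of k A (1 : A))
        (w j ⟨Finset.univ, by rw [Finset.card_univ, Fintype.card_fin, hij]⟩) ∧
      Submodule.Quotient.mk z = y

end Comparison

/-! ### The maps `κ^i` and `ι_j` -/

section CompletionMaps

variable (k : Type u) [Field k] [CharZero k] (n : ℕ) (M : Type v) [AddCommGroup M] [Module k M]
  [Module (PolyR k n) M] [Module (DiffOp k (PolyR k n)) M]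
  [IsScalarTower k (DiffOp k (PolyR k n)) M]
  [IsScalarTower (PolyR k n) (DiffOp k (PolyR k n)) M]

/-- `κ : M → M̂` as a map over `𝒟 → 𝒟̂`. -/
def kappaSemilinear : M →ₛₗ[(extendOp k n).toRingHom] Completion k n M where
  toFun := kappa k n
  map_add' := kappa_add k n
  map_smul' := kappa_smul k n

theorem kappa_smul_field (c : k) (m : M) : kappa k n (c • m) = c • kappa k n m := by
  rw [← algebraMap_smul (DiffOp k (PolyR k n)) c m, kappa_smul, AlgHom.commutes, algebraMap_smul]

/-- `κ` applied to each summand of `Ω^i(M)`. -/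
def kappaForm (i : ℕ) : DRForm n i M →ₗ[k] DRForm n i (Completion k n M) where
  toFun ω s := kappa k n (ω s)
  map_add' ω η := funext fun s => kappa_add k n (ω s) (η s)
  map_smul' c ω := funext fun s => kappa_smul_field k n M c (ω s)

theorem kappaForm_dRham (i : ℕ) (ω : DRForm n i M) :
    kappaForm k n M (i + 1) (dRham k (PolyR k n) M i ω)
      = dRham k (PowR k n) (Completion k n M) i (kappaForm k n M i ω) := by
  funext t
  show kappaSemilinear k n M (∑ s : {s // s ∈ t.1}, _) = ∑ s : {s // s ∈ t.1}, _
  rw [map_sum]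
  refine Finset.sum_congr rfl fun s _ => ?_
  rw [map_zsmul]
  congr 1
  have e : extendOp k n (dd k (PolyR k n) s.1) = dd k (PowR k n) s.1 := DiffOp.lift_dd _ _ _ _ _
  rw [← e]
  exact kappa_smul k n _ _

/-- `κ^i : H^i_dR(M) → H^i_dR(M̂)` -/
def kappaCoh (i : ℕ) :
    HdR k (PolyR k n) M i →ₗ[k] HdR k (PowR k n) (Completion k n M) i :=
  SubQuot.map (kappaForm k n M i)
    (fun ω hω => by
      rw [LinearMap.mem_ker] at hω ⊢
      rw [← kappaForm_dRham, hω, map_zero])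
    (by
      cases i with
      | zero =>
        intro ω hω
        rw [(Submodule.mem_bot k).mp hω, map_zero]
        exact Submodule.zero_mem _
      | succ i =>
        rintro _ ⟨η, rfl⟩
        exact ⟨_, (kappaForm_dRham k n M i η).symm⟩)

/-- The inclusion `R^τ → R̂^τ`. -/
def transposeIncl :
    Transpose k (PolyR k n) (PolyR k n) →ₗ[k] Transpose k (PowR k n) (PowR k n) :=
  (Transpose.of k (PowR k n)).toLinearMap ∘ₗ (polyToPow k n).toLinearMap ∘ₗ
    (Transpose.of k (PolyR k n)).symm.toLinearMap

theorem transposeIncl_smul (δ : DiffOp k (PolyR k n)) (r : Transpose k (PolyR k n) (PolyR k n)) :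
    transposeIncl k n (op δ • r) = op (extendOp k n δ) • transposeIncl k n r := by
  show polyToPow k n (tau k (PolyR k n) δ • (Transpose.of k (PolyR k n)).symm r)
    = tau k (PowR k n) (extendOp k n δ)
      • polyToPow k n ((Transpose.of k (PolyR k n)).symm r)
  rw [tau_extendOp, extendOp_smul_polyToPow]

/-- `ι_j : Tor_j^𝒟(R^τ, M) → Tor_j^𝒟̂(R̂^τ, M̂)`, induced by `R^τ → R̂^τ` and `κ : M → M̂` -/
def iota (j : ℕ) :
    TorSpace k (DiffOp k (PolyR k n)) (Transpose k (PolyR k n) (PolyR k n)) M j →ₗ[k]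
      TorSpace k (DiffOp k (PowR k n)) (Transpose k (PowR k n) (PowR k n)) (Completion k n M) j :=
  torMap (extendOp k n) (transposeIncl k n) (transposeIncl_smul k n) (kappaSemilinear k n M) j

end CompletionMaps

end

noncomputable section

universe u v w

set_option linter.unusedSectionVars false

/-! Let `F_• → N` be the canonical free resolution over `𝒟(A, k)`, where `A` has coordinates; both
`R` and `R̂` are of this kind, so one argument serves both rows of the square. Consider the double
complex `Ω^a(F_p)`. For fixed `a` it is a finite sum of copies of `F_•`, hence a resolution of
`Ω^a(N)`. For fixed `p` it is the de Rham complex of a free module, which is exact below degree `n`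
and has cokernel `A^τ ⊗_𝒟 F_p` in degree `n`. So both augmentations of the total complex are
quasi-isomorphisms, and `H^i_dR(N)` is identified with `Tor_{n-i}(A^τ, N)`.

Exactness below degree `n` (`mem_dRhamBoundaries_of_free`) comes from an Euler homotopy. The
commutators `D_s = [-, x_s]` satisfy `[D_r, ∂_s] = δ_{rs}`. Contracting with them gives an operator
whose anticommutator with the de Rham differential is `E + (n - i)` in degree `i`, where `E = ∑ ∂_s
D_s`. The operators `∂^α a` span `𝒟` and are eigenvectors of `E` with eigenvalue `|α|`, so in
characteristic zero `E + (n - i)` is invertible for `i < n`. In degree `n` one uses that `P ↦ 1 · P`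
induces an isomorphism from `𝒟 / ∑ ∂_s 𝒟` to `A^τ` (`exists_sum_dd_mul_of_op_smul_one`,
`mem_dRhamBoundaries_of_oneTmul`).

The comparison map is specified by total cycles, so it is built as a linear relation: a class and a
Tor element are related when one total cycle maps to both. Four diagram chases show that this
relation is total and single-valued in both directions, hence the graph of an isomorphism
(`exists_isComparison`).

The square commutes because `κ` induces a map of canonical resolutions over `𝒟 → 𝒟̂`, which carries
total cycles to total cycles and respects both augmentations (`IsComparison.naturality`). Flatness
of `R̂` over `R` plays no role. -/

/-! ### Signs -/

/-- The sign of `dx_s ∧ dx_{t \ {s}}`, for `s ∈ t`. -/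
def wedgeSign {n : ℕ} (s : Fin n) (t : Finset (Fin n)) : ℤ := (-1) ^ (t.filter (· < s)).card

section WedgeSign

variable {n : ℕ}

theorem wedgeSign_mul_self (s : Fin n) (t : Finset (Fin n)) :
    wedgeSign s t * wedgeSign s t = 1 := by
  rw [wedgeSign, ← mul_pow, neg_one_mul, neg_neg, one_pow]

theorem wedgeSign_insert {r : Fin n} {t : Finset (Fin n)} (hr : r ∉ t) (s : Fin n) :
    wedgeSign s (insert r t) = (if r < s then -1 else 1) * wedgeSign s t := by
  rw [wedgeSign, wedgeSign, Finset.filter_insert]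
  split_ifs with h
  · rw [Finset.card_insert_of_notMem fun h' => hr (Finset.mem_filter.mp h').1, pow_succ', neg_one_mul]
  · rw [one_mul]

theorem wedgeSign_erase {r : Fin n} {t : Finset (Fin n)} (hr : r ∈ t) (s : Fin n) :
    wedgeSign s (t.erase r) = (if r < s then -1 else 1) * wedgeSign s t := by
  have h := wedgeSign_insert (Finset.notMem_erase r t) s
  rw [Finset.insert_erase hr] at h
  rw [h, ← mul_assoc]
  split_ifs <;> simp

theorem wedgeSign_erase_self (s : Fin n) (t : Finset (Fin n)) :
    wedgeSign s (t.erase s) = wedgeSign s t := by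
  by_cases h : s ∈ t
  · rw [wedgeSign_erase h, if_neg (lt_irrefl s), one_mul]
  · rw [Finset.erase_eq_of_notMem h]

/-- Exactly one of `s < r` and `r < s` holds, so exactly one of the two removals changes the other
sign. This is the anticommutation of `dx_s` and `dx_r`, and it yields `d² = 0`. -/
theorem wedgeSign_erase_swap {s r : Fin n} {t : Finset (Fin n)} (hs : s ∈ t) (hr : r ∈ t)
    (h : s ≠ r) :
    wedgeSign s t * wedgeSign r (t.erase s) = -(wedgeSign r t * wedgeSign s (t.erase r)) := by
  rw [wedgeSign_erase hs, wedgeSign_erase hr]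
  rcases lt_or_gt_of_ne h with h | h
  · rw [if_pos h, if_neg h.not_gt]; ring
  · rw [if_pos h, if_neg h.not_gt]; ring

/-- The anticommutation of `dx_s ∧` with the contraction along `∂_r` for `r ≠ s`; it cancels the
mixed terms of the Euler homotopy. -/
theorem wedgeSign_insert_erase {s r : Fin n} {t : Finset (Fin n)} (hs : s ∈ t) (hr : r ∉ t) :
    wedgeSign r t * wedgeSign s (insert r t) = -(wedgeSign s t * wedgeSign r (t.erase s)) := by
  rw [wedgeSign_erase hs, wedgeSign_insert hr]
  have h : s ≠ r := fun h => hr (h ▸ hs)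
  rcases lt_or_gt_of_ne h with h | h
  · rw [if_pos h, if_neg h.not_gt]; ring
  · rw [if_pos h, if_neg h.not_gt]; ring

end WedgeSign

/-! ### Inhomogeneous forms

An inhomogeneous form is a function on all subsets of `{1, …, n}`. -/

/-- The component of degree `i` of an inhomogeneous form. -/
def formOf {n : ℕ} {N : Type w} (i : ℕ) (g : Finset (Fin n) → N) : DRForm n i N := fun t => g t.1

/-- Extension by zero. Functions on all subsets keep proofs about cardinality out of the sums over
erased and inserted elements. -/
theorem exists_formOf_eq {n i : ℕ} {N : Type w} [Zero N] (ω : DRForm n i N) :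
    ∃ g : Finset (Fin n) → N, formOf i g = ω := by
  classical
  refine ⟨fun t => if h : t.card = i then ω ⟨t, h⟩ else 0, funext fun t => ?_⟩
  exact dif_pos t.2

section TotalForms

variable (k : Type u) [Field k] (A : Type v) [CommRing A] [Algebra k A] {n : ℕ}
  [Coordinates k A n] {N : Type w} [AddCommGroup N] [Module k N] [Module (DiffOp k A) N]
  [IsScalarTower k (DiffOp k A) N]

/-- The de Rham differential of an inhomogeneous form. -/
def totalD (g : Finset (Fin n) → N) (t : Finset (Fin n)) : N :=
  ∑ s ∈ t, wedgeSign s t • dd k A s • g (t.erase s)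

theorem dRham_formOf (i : ℕ) (g : Finset (Fin n) → N) :
    dRham k A N i (formOf i g) = formOf (i + 1) (totalD k A g) :=
  funext fun t => Finset.sum_coe_sort t.1 fun s => wedgeSign s t.1 • dd k A s • g (t.1.erase s)

/-- In degree zero the differential is an empty sum, which matches the convention that the
boundaries there are zero; so later arguments need no case split on the degree. -/
theorem formOf_totalD_mem (i : ℕ) (g : Finset (Fin n) → N) :
    formOf i (totalD k A g) ∈ dRhamBoundaries k A N i := by
  cases i with
  | zero =>
    refine (Submodule.mem_bot k).mpr (funext fun t => ?_)
    obtain ⟨t, ht⟩ := t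
    obtain rfl := Finset.card_eq_zero.mp ht
    exact Finset.sum_empty (f := fun s => wedgeSign s ∅ • dd k A s • g (Finset.erase ∅ s))
  | succ i => exact ⟨formOf i g, dRham_formOf k A i g⟩

/-- The terms indexed by `(s, r)` and `(r, s)` cancel: the operators `∂_s`, `∂_r` commute and the
signs are opposite. -/
theorem totalD_totalD (g : Finset (Fin n) → N) : totalD k A (totalD k A g) = 0 := by
  funext t
  simp only [totalD, Finset.smul_sum, Pi.zero_apply]
  rw [Finset.sum_sigma']
  refine Finset.sum_involution (fun p _ => ⟨p.2, p.1⟩) ?_ ?_ ?_ ?_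
  · rintro ⟨s, r⟩ h
    simp only [Finset.mem_sigma, Finset.mem_erase] at h
    obtain ⟨hs, hrs, hr⟩ := h
    simp only
    rw [smul_comm (dd k A s) (wedgeSign r (t.erase s)), smul_comm (dd k A r) (wedgeSign s (t.erase r)),
      ← mul_smul, ← mul_smul, wedgeSign_erase_swap hs hr hrs.symm, ← mul_smul, ← mul_smul,
      (dd_comm s r).eq, Finset.erase_right_comm, neg_smul, neg_add_cancel]
  · rintro ⟨s, r⟩ h _ e
    simp only [Finset.mem_sigma, Finset.mem_erase] at h
    exact h.2.1 (congrArg Sigma.fst e)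
  · rintro ⟨s, r⟩ h
    simp only [Finset.mem_sigma, Finset.mem_erase] at h ⊢
    exact ⟨h.2.2, h.2.1.symm, h.1⟩
  · rintro ⟨s, r⟩ _
    rfl

theorem dRham_dRham (i : ℕ) (ω : DRForm n i N) :
    dRham k A N (i + 1) (dRham k A N i ω) = 0 := by
  obtain ⟨g, rfl⟩ := exists_formOf_eq ω
  rw [dRham_formOf, dRham_formOf, totalD_totalD]
  rfl

theorem dRham_eq_zero_of_mem (i : ℕ) {ω : DRForm n i N} (h : ω ∈ dRhamBoundaries k A N i) :
    dRham k A N i ω = 0 := by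
  cases i with
  | zero => rw [(Submodule.mem_bot k).mp h, map_zero]
  | succ i => obtain ⟨η, rfl⟩ := h; exact dRham_dRham k A i η

/-! ### The Euler homotopy -/

/-- The operator `∑ D_s ι_s` on inhomogeneous forms, where `ι_s` is the contraction with `∂_s`. -/
def totalContract (D : Fin n → N →ₗ[k] N) (g : Finset (Fin n) → N) (t : Finset (Fin n)) : N :=
  ∑ s ∈ tᶜ, wedgeSign s t • D s (g (insert s t))

/-- The operator `∑ ∂_s D_s`. -/
def eulerOp (D : Fin n → N →ₗ[k] N) : N →ₗ[k] N where
  toFun v := ∑ s, dd k A s • D s v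
  map_add' v v' := by simp only [map_add, smul_add, Finset.sum_add_distrib]
  map_smul' c v := by
    simp only [map_smul, RingHom.id_apply, Finset.smul_sum]
    exact Finset.sum_congr rfl fun s _ => smul_comm _ _ _

/-- A Cartan formula. Mixed terms cancel by anticommutation. The diagonal terms contribute `∂_s D_s`
for `s ∈ t` and `D_r ∂_r = ∂_r D_r + 1` for `r ∉ t`; the extra identities account for `n - |t|`. -/
theorem totalD_totalContract_add (D : Fin n → N →ₗ[k] N)
    (hD : ∀ r s v, D r (dd k A s • v) = dd k A s • D r v + if r = s then v else 0)
    (g : Finset (Fin n) → N) (t : Finset (Fin n)) :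
    totalD k A (totalContract k D g) t + totalContract k D (totalD k A g) t
      = eulerOp k A D (g t) + (n - t.card) • g t := by
  have h1 : totalD k A (totalContract k D g) t
      = ∑ s ∈ t, (dd k A s • D s (g t) + ∑ r ∈ tᶜ,
        (wedgeSign s t * wedgeSign r (t.erase s)) • dd k A s • D r (g (insert r (t.erase s)))) := by
    refine Finset.sum_congr rfl fun s hs => ?_
    -- The index `s` is now absent from the set, so it may be inserted again; this gives the
    -- diagonal term.
    have e : (t.erase s)ᶜ = insert s tᶜ := Finset.compl_erase
    rw [totalContract, e, Finset.sum_insert (by simpa using hs), Finset.insert_erase hs,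
      wedgeSign_erase_self, smul_add, smul_add, smul_comm (dd k A s), ← mul_smul,
      wedgeSign_mul_self, one_smul, Finset.smul_sum, Finset.smul_sum]
    congr 1
    refine Finset.sum_congr rfl fun r _ => ?_
    rw [smul_comm (dd k A s), ← mul_smul]
  have h2 : totalContract k D (totalD k A g) t
      = ∑ r ∈ tᶜ, (dd k A r • D r (g t) + g t - ∑ s ∈ t,
        (wedgeSign s t * wedgeSign r (t.erase s)) • dd k A s • D r (g (insert r (t.erase s)))) := by
    refine Finset.sum_congr rfl fun r hr => ?_
    have hr : r ∉ t := Finset.mem_compl.mp hr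
    rw [totalD, Finset.sum_insert hr, Finset.erase_insert hr, map_add, map_zsmul, smul_add,
      ← mul_smul, wedgeSign_insert hr, if_neg (lt_irrefl r), one_mul, wedgeSign_mul_self, one_smul,
      hD, if_pos rfl, sub_eq_add_neg, map_sum, Finset.smul_sum, ← Finset.sum_neg_distrib]
    congr 1
    refine Finset.sum_congr rfl fun s hs => ?_
    have hne : r ≠ s := fun h => hr (h ▸ hs)
    rw [map_zsmul, hD, if_neg hne, add_zero, ← mul_smul, wedgeSign_insert_erase hs hr, neg_smul,
      Finset.erase_insert_of_ne hne]
  rw [h1, h2, Finset.sum_add_distrib, Finset.sum_sub_distrib, Finset.sum_add_distrib,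
    Finset.sum_comm, Finset.sum_const, Finset.card_compl, Fintype.card_fin]
  have h3 : eulerOp k A D (g t) = ∑ s ∈ t, dd k A s • D s (g t) + ∑ s ∈ tᶜ, dd k A s • D s (g t) :=
    (Finset.sum_add_sum_compl t _).symm
  rw [h3]
  abel

/-- If the operators `D_r` satisfy `[D_r, ∂_s] = δ_{rs}` and the Euler operator `∑ ∂_s D_s` is
diagonalizable with eigenvalues in `ℕ`, then the de Rham complex is exact below the top degree. -/
theorem mem_dRhamBoundaries_of_euler [CharZero k] (D : Fin n → N →ₗ[k] N)
    (hD : ∀ r s v, D r (dd k A s • v) = dd k A s • D r v + if r = s then v else 0)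
    (hE : Submodule.span k {v : N | ∃ m : ℕ, eulerOp k A D v = (m : k) • v} = ⊤)
    {i : ℕ} (hi : i < n) (ω : DRForm n i N) (hω : dRham k A N i ω = 0) :
    ω ∈ dRhamBoundaries k A N i := by
  classical
  let θ : DRForm n i N →ₗ[k] DRForm n i N := LinearMap.compLeft (eulerOp k A D) _
  -- On closed forms the second half of the homotopy vanishes, so `θ` acts as `-(n - i)` modulo
  -- boundaries.
  have hθ : ∀ ω : DRForm n i N, dRham k A N i ω = 0 →
      θ ω + ((n - i : ℕ) : k) • ω ∈ dRhamBoundaries k A N i := by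
    intro ω hω
    obtain ⟨g, rfl⟩ := exists_formOf_eq ω
    have h := formOf_totalD_mem k A i (totalContract k D g)
    convert h using 1
    funext t
    have e := totalD_totalContract_add k A D hD g t.1
    have e0 : totalContract k D (totalD k A g) t.1 = 0 := by
      refine Finset.sum_eq_zero fun s hs => ?_
      rw [dRham_formOf] at hω
      have := congrFun hω ⟨insert s t.1, by
        rw [Finset.card_insert_of_notMem (Finset.mem_compl.mp hs), t.2]⟩
      change totalD k A g (insert s t.1) = 0 at this
      rw [this, map_zero, smul_zero]
    rw [e0, add_zero, t.2] at e
    change eulerOp k A D (g t.1) + ((n - i : ℕ) : k) • g t.1 = _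
    rw [Nat.cast_smul_eq_nsmul, ← e]
    rfl
  have hspan : ∀ ω : DRForm n i N, ω ∈ Submodule.span k {ω | ∃ m : ℕ, θ ω = (m : k) • ω} := by
    intro ω
    rw [← Finset.univ_sum_single ω]
    refine Submodule.sum_mem _ fun t _ => ?_
    have h : ω t ∈ Submodule.span k {v : N | ∃ m : ℕ, eulerOp k A D v = (m : k) • v} :=
      hE ▸ Submodule.mem_top
    have h' := Submodule.apply_mem_span_image_of_mem_span (LinearMap.single k (fun _ => N) t) h
    refine Submodule.span_mono ?_ h'
    rintro _ ⟨v, ⟨m, hm⟩, rfl⟩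
    refine ⟨m, funext fun t' => ?_⟩
    change eulerOp k A D ((Pi.single t v : DRForm n i N) t') = (m : k) • (Pi.single t v : DRForm n i N) t'
    by_cases h : t' = t
    · subst h; simpa using hm
    · simp [Pi.single_eq_of_ne h]
  -- Every form is a finite sum of eigenvectors with eigenvalues in `ℕ`, so some product `∏_{m < M}
  -- (θ - m)` kills it.
  let p : ℕ → Polynomial k := fun M =>
    ∏ m ∈ Finset.range M, (Polynomial.X - Polynomial.C (m : k))
  have hsucc : ∀ M ω, Polynomial.aeval θ (p (M + 1)) ω
      = Polynomial.aeval θ (p M) (θ ω - (M : k) • ω) := by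
    intro M ω
    simp only [p, Finset.prod_range_succ, map_mul, Module.End.mul_apply, map_sub,
      Polynomial.aeval_X, Polynomial.aeval_C, LinearMap.sub_apply,
      Module.algebraMap_end_apply]
  have hmono : ∀ M M' ω, M ≤ M' → Polynomial.aeval θ (p M) ω = 0 →
      Polynomial.aeval θ (p M') ω = 0 := by
    intro M M' ω hM h
    obtain ⟨q, hq⟩ : p M ∣ p M' :=
      Finset.prod_dvd_prod_of_subset _ _ _ (Finset.range_mono hM)
    rw [hq, mul_comm, map_mul, Module.End.mul_apply, h, map_zero]
  have hann : ∀ ω, ∃ M, Polynomial.aeval θ (p M) ω = 0 := by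
    intro ω
    induction hspan ω using Submodule.span_induction with
    | mem ω h =>
      obtain ⟨m, hm⟩ := h
      exact ⟨m + 1, by rw [hsucc, hm, sub_self, map_zero]⟩
    | zero => exact ⟨0, map_zero _⟩
    | add ω η _ _ h h' =>
      obtain ⟨M, h⟩ := h
      obtain ⟨M', h'⟩ := h'
      exact ⟨max M M', by
        rw [map_add, hmono _ _ _ (le_max_left M M') h, hmono _ _ _ (le_max_right M M') h', add_zero]⟩
    | smul c ω _ h =>
      obtain ⟨M, h⟩ := h
      exact ⟨M, by rw [map_smul, h, smul_zero]⟩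
  -- Induction on the number of factors: `θ ω - M ω` is killed by one factor fewer, hence is a
  -- boundary. Subtracting it from the boundary `θ ω + (n - i) ω` leaves `(n - i + M) ω`, whose
  -- scalar is nonzero because `i < n`.
  obtain ⟨M, hM⟩ := hann ω
  induction M generalizing ω with
  | zero =>
    have h0 : ω = 0 := by simpa [p] using hM
    exact h0 ▸ Submodule.zero_mem _
  | succ M ih =>
    rw [hsucc] at hM
    have h1 := hθ ω hω
    have h2 : θ ω - (M : k) • ω ∈ dRhamBoundaries k A N i := by
      refine ih _ ?_ hM
      -- That `θ ω` is closed follows from `h1`, so `θ` need not be shown to commute with the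
      -- differential.
      have h3 := dRham_eq_zero_of_mem k A i h1
      rw [map_add, map_smul, hω, smul_zero, add_zero] at h3
      rw [map_sub, map_smul, h3, hω, smul_zero, sub_zero]
    have h3 := Submodule.sub_mem _ h1 h2
    rw [add_sub_sub_cancel, ← add_smul, ← Nat.cast_add] at h3
    exact (Submodule.smul_mem_iff _ (Nat.cast_ne_zero.mpr (by omega))).mp h3

end TotalForms

/-! ### The de Rham complex of a free module -/

section FreeModules

open Coordinates

variable (k : Type u) [Field k] (A : Type v) [CommRing A] [Algebra k A] {n : ℕ}
  [Coordinates k A n]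

/-- The commutator `P ↦ [P, x_s]` -/
def commX (s : Fin n) : DiffOp k A →ₗ[k] DiffOp k A :=
  LinearMap.mulRight k (DiffOp.mulOp (x k s)) - LinearMap.mulLeft k (DiffOp.mulOp (x k s))

theorem commX_apply (s : Fin n) (P : DiffOp k A) :
    commX k A s P = P * DiffOp.mulOp (x k s) - DiffOp.mulOp (x k s) * P := rfl

/-- The commutator with `x_r` is a derivation of `𝒟`, and `[∂_s, x_r] = δ_{rs}`. -/
theorem commX_dd_mul (r s : Fin n) (P : DiffOp k A) :
    commX k A r (dd k A s * P) = dd k A s * commX k A r P + if r = s then P else 0 := by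
  have h := dd_mulOp s (x k r : A) (k := k)
  rw [pd_x] at h
  have h' : DiffOp.mulOp (x k r) * dd k A s
      = dd k A s * DiffOp.mulOp (x k r) - DiffOp.mulOp (if s = r then 1 else 0 : A) :=
    eq_sub_of_add_eq h.symm
  rw [commX_apply, commX_apply, ← mul_assoc (DiffOp.mulOp (x k r)), h', mul_sub, sub_mul,
    mul_assoc, mul_assoc]
  by_cases e : s = r
  · subst e; simp [sub_add]
  · simp [e, Ne.symm e]

theorem commX_mulOp (s : Fin n) (a : A) : commX k A s (DiffOp.mulOp a) = 0 := by
  rw [commX_apply, ← map_mul, ← map_mul, mul_comm, sub_self]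

/-- That is, `[E, ∂_r] = ∂_r` for left multiplication by `∂_r`: each factor on the left raises the
eigenvalue by one. -/
theorem eulerOp_commX_dd_mul (r : Fin n) (P : DiffOp k A) :
    eulerOp k A (commX k A) (dd k A r * P)
      = dd k A r * eulerOp k A (commX k A) P + dd k A r * P := by
  show ∑ s, dd k A s * commX k A s (dd k A r * P)
    = dd k A r * ∑ s, dd k A s * commX k A s P + dd k A r * P
  have h : ∀ s, dd k A s * commX k A s (dd k A r * P)
      = dd k A r * (dd k A s * commX k A s P) + if s = r then dd k A s * P else 0 := by
    intro s
    rw [commX_dd_mul, mul_add, ← mul_assoc, ← mul_assoc, (dd_comm s r).eq, mul_ite, mul_zero]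
  simp only [h, Finset.sum_add_distrib, Finset.mul_sum]
  simp

/-- Functions commute with the coordinates, so they have eigenvalue zero. Writing the derivatives on
the left makes these products exact eigenvectors. -/
theorem eulerOp_commX_opMon_mul_mulOp (α : Fin n →₀ ℕ) (a : A) :
    eulerOp k A (commX k A) (opMon (dd k A) α * DiffOp.mulOp a)
      = ((α.degree : ℕ) : k) • (opMon (dd k A) α * DiffOp.mulOp a) := by
  induction α using opMon_induction with
  | h0 =>
    rw [opMon_zero, one_mul, map_zero, Nat.cast_zero, zero_smul]
    show ∑ s, dd k A s • commX k A s (DiffOp.mulOp a) = 0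
    simp only [commX_mulOp, smul_zero, Finset.sum_const_zero]
  | h1 α i ih =>
    rw [opMon_add_single _ dd_comm, mul_assoc, eulerOp_commX_dd_mul, ih, map_add,
      Finsupp.degree_single, Nat.cast_add, Nat.cast_one, add_smul, one_smul, mul_smul_comm]

/-- Every differential operator is a sum of operators `∂^α a`. -/
theorem span_opMon_mul_mulOp [CharZero k] :
    Submodule.span k {P : DiffOp k A | ∃ (α : Fin n →₀ ℕ) (a : A),
      P = opMon (dd k A) α * DiffOp.mulOp a} = ⊤ := by
  set W := Submodule.span k {P : DiffOp k A | ∃ (α : Fin n →₀ ℕ) (a : A),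
      P = opMon (dd k A) α * DiffOp.mulOp a} with hW
  have hdd : ∀ i, ∀ P ∈ W, dd k A i * P ∈ W := by
    intro i P hP
    induction hP using Submodule.span_induction with
    | mem P h =>
      obtain ⟨α, a, rfl⟩ := h
      exact Submodule.subset_span
        ⟨α + Finsupp.single i 1, a, by rw [opMon_add_single _ dd_comm, mul_assoc]⟩
    | zero => rw [mul_zero]; exact W.zero_mem
    | add P Q _ _ hP hQ => rw [mul_add]; exact W.add_mem hP hQ
    | smul c P _ hP => rw [mul_smul_comm]; exact W.smul_mem c hP
  have hmon : ∀ (α : Fin n →₀ ℕ) (a : A), DiffOp.mulOp a * opMon (dd k A) α ∈ W := by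
    intro α
    induction α using opMon_induction with
    | h0 =>
      intro a
      exact Submodule.subset_span ⟨0, a, by rw [opMon_zero, mul_one, one_mul]⟩
    | h1 α i ih =>
      intro a
      -- The Leibniz rule moves one `∂_i` to the left; both resulting terms fall under the induction
      -- hypothesis, which is stated for all functions.
      have e : DiffOp.mulOp a * opMon (dd k A) (α + Finsupp.single i 1)
          = dd k A i * (DiffOp.mulOp a * opMon (dd k A) α)
            - DiffOp.mulOp (pd (k := k) i a) * opMon (dd k A) α := by
        rw [opMon_add_single _ dd_comm, ← mul_assoc, ← mul_assoc, dd_mulOp, add_mul,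
          add_sub_cancel_right]
      rw [e]
      exact W.sub_mem (hdd i _ (ih a)) (ih _)
  refine (Submodule.eq_top_iff').mpr fun P => ?_
  obtain ⟨c, rfl⟩ := opExpand_dd_surjective P
  induction c using Finsupp.induction_linear with
  | zero => rw [map_zero]; exact W.zero_mem
  | add c c' h h' => rw [map_add]; exact W.add_mem h h'
  | single α a => rw [opExpand_single]; exact hmon α a

/-- The de Rham complex of a free module is exact below the top degree. -/
theorem mem_dRhamBoundaries_of_free [CharZero k] (S : Type w) {i : ℕ} (hi : i < n)
    (ω : DRForm n i (S →₀ DiffOp k A)) (hω : dRham k A (S →₀ DiffOp k A) i ω = 0) :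
    ω ∈ dRhamBoundaries k A (S →₀ DiffOp k A) i := by
  -- The commutators act on each coordinate of the free module, and the Euler eigenvectors are the
  -- basis vectors with a single coefficient `∂^α a`.
  let C : Fin n → (S →₀ DiffOp k A) →ₗ[k] (S →₀ DiffOp k A) := fun s =>
    Finsupp.mapRange.linearMap (commX k A s)
  refine mem_dRhamBoundaries_of_euler k A C ?_ ?_ hi ω hω
  · intro r s v
    ext y : 1
    have h := commX_dd_mul k A r s (v y)
    show commX k A r (dd k A s * v y) = dd k A s * commX k A r (v y)
      + (if r = s then v else 0 : S →₀ DiffOp k A) y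
    rw [h]
    split_ifs <;> rfl
  · refine (Submodule.eq_top_iff').mpr fun v => ?_
    induction v using Finsupp.induction_linear with
    | zero => exact Submodule.zero_mem _
    | add v v' h h' => exact Submodule.add_mem _ h h'
    | single y P =>
      have hP : P ∈ Submodule.span k {P : DiffOp k A | ∃ (α : Fin n →₀ ℕ) (a : A),
        P = opMon (dd k A) α * DiffOp.mulOp a} := by
        rw [span_opMon_mul_mulOp]; exact Submodule.mem_top
      have h := Submodule.apply_mem_span_image_of_mem_span (Finsupp.lsingle (R := k) y) hP
      refine Submodule.span_mono ?_ h
      rintro _ ⟨_, ⟨α, a, rfl⟩, rfl⟩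
      refine ⟨α.degree, ?_⟩
      have e := eulerOp_commX_opMon_mul_mulOp k A α a
      rw [← map_smul, ← e]
      show ∑ s, dd k A s • C s (Finsupp.single y _) = Finsupp.single y (∑ s, dd k A s • commX k A s _)
      rw [← Finsupp.lsingle_apply (R := k), ← Finsupp.lsingle_apply (R := k), map_sum]
      refine Finset.sum_congr rfl fun s _ => ?_
      show dd k A s • Finsupp.mapRange _ (map_zero (commX k A s)) (Finsupp.single y _) = Finsupp.single y _
      rw [Finsupp.mapRange_single, Finsupp.smul_single]

/-! ### The top degree: functions as differential operators modulo `∑ ∂_s 𝒟`. -/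

variable [CharZero k]

theorem tau_mulOp (a : A) : tau k A (DiffOp.mulOp a) = DiffOp.mulOp a := by
  have h := tau_mulOp_mul_opMon k A a 0
  simpa [opMon_zero] using h

instance : IsScalarTower k (DiffOp k A)ᵐᵒᵖ (Transpose k A A) := ⟨fun c P r => by
  show tau k A (c • unop P) • (Transpose.of k A).symm r
    = c • (tau k A (unop P) • (Transpose.of k A).symm r)
  rw [tau, map_smul, unop_smul, smul_assoc]
  rfl⟩

/-- The transpose of `∂_i` is `-∂_i`, which kills constants. -/
theorem op_dd_smul_one (i : Fin n) : op (dd k A i) • Transpose.of k A (1 : A) = 0 := by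
  rw [Transpose.op_smul_of, tau, transposition, DiffOp.lift_dd, unop_op, neg_smul, dd,
    DiffOp.ofDerivation_smul, Derivation.map_one_eq_zero, neg_zero, map_zero]

theorem op_mulOp_smul_one (a : A) :
    op (DiffOp.mulOp a : DiffOp k A) • Transpose.of k A (1 : A) = Transpose.of k A a := by
  rw [Transpose.op_smul_of, tau_mulOp, DiffOp.mulOp_smul, mul_one]

/-- Every differential operator is congruent to a function modulo `∑ ∂_s 𝒟`. -/
theorem exists_mulOp_add_sum_dd_mul (P : DiffOp k A) :
    ∃ (a : A) (Q : Fin n → DiffOp k A), P = DiffOp.mulOp a + ∑ s, dd k A s * Q s := by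
  have hP : P ∈ Submodule.span k {P : DiffOp k A | ∃ (α : Fin n →₀ ℕ) (a : A),
      P = opMon (dd k A) α * DiffOp.mulOp a} := by
    rw [span_opMon_mul_mulOp]; exact Submodule.mem_top
  induction hP using Submodule.span_induction with
  | mem P h =>
    obtain ⟨α, a, rfl⟩ := h
    induction α using opMon_induction with
    | h0 => exact ⟨a, 0, by simp [opMon_zero]⟩
    | h1 α i _ =>
      refine ⟨0, Pi.single i (opMon (dd k A) α * DiffOp.mulOp a), ?_⟩
      rw [opMon_add_single _ dd_comm, map_zero, zero_add, Finset.sum_eq_single i,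
        Pi.single_eq_same, mul_assoc]
      · intro j _ hj
        rw [Pi.single_eq_of_ne hj, mul_zero]
      · intro h
        exact absurd (Finset.mem_univ i) h
  | zero => exact ⟨0, 0, by simp⟩
  | add P P' _ _ h h' =>
    obtain ⟨a, Q, rfl⟩ := h
    obtain ⟨a', Q', rfl⟩ := h'
    refine ⟨a + a', Q + Q', ?_⟩
    simp only [map_add, Pi.add_apply, mul_add, Finset.sum_add_distrib]
    abel
  | smul c P _ h =>
    obtain ⟨a, Q, rfl⟩ := h
    refine ⟨c • a, c • Q, ?_⟩
    simp only [map_smul, Pi.smul_apply, mul_smul_comm, smul_add, Finset.smul_sum]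

/-- A differential operator `P` with `1 · P = 0` in `A^τ` lies in `∑ ∂_s 𝒟`. -/
theorem exists_sum_dd_mul_of_op_smul_one (P : DiffOp k A)
    (hP : op P • Transpose.of k A (1 : A) = 0) :
    ∃ Q : Fin n → DiffOp k A, P = ∑ s, dd k A s * Q s := by
  obtain ⟨a, Q, rfl⟩ := exists_mulOp_add_sum_dd_mul k A P
  refine ⟨Q, ?_⟩
  -- The part in `∑ ∂_s 𝒟` acts on `1` by zero, so `1 · P` is the function `a` itself.
  have h : a = 0 := by
    rw [op_add, add_smul, op_mulOp_smul_one, Finset.op_sum, Finset.sum_smul,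
      Finset.sum_eq_zero, add_zero] at hP
    · exact (LinearEquiv.map_eq_zero_iff _).mp hP
    · intro s _
      rw [op_mul, mul_smul, op_dd_smul_one, smul_zero]
  rw [h, map_zero, zero_add]

/-- A sum `∑ ∂_s v_s` is a boundary in top degree. -/
theorem top_mem_dRhamBoundaries {N : Type w} [AddCommGroup N] [Module k N] [Module (DiffOp k A) N]
    [IsScalarTower k (DiffOp k A) N] {i : ℕ} (hi : i = n) (v : Fin n → N) :
    (fun _ => ∑ s, dd k A s • v s : DRForm n i N) ∈ dRhamBoundaries k A N i := by
  -- The primitive has coefficient `± v_s` on the complement of `{s}`. The sum over `tᶜ` gives this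
  -- by one formula; only subsets missing a single element contribute.
  convert formOf_totalD_mem k A i
    (fun t => ∑ s ∈ tᶜ, wedgeSign s (Finset.univ : Finset (Fin n)) • v s) using 1
  funext t
  have ht : t.1 = Finset.univ := by
    rw [← Finset.card_eq_iff_eq_univ, t.2, hi, Fintype.card_fin]
  show _ = totalD k A _ t.1
  rw [ht, totalD]
  refine Finset.sum_congr rfl fun s _ => ?_
  rw [Finset.compl_erase, Finset.compl_univ, insert_empty_eq, Finset.sum_singleton,
    smul_comm (dd k A s), ← mul_smul, wedgeSign_mul_self, one_smul]

/-! ### The tensor product `A^τ ⊗_𝒟 F` -/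

/-- The coordinate `A^τ ⊗_𝒟 𝒟^{(S)} → A^τ` at `y ∈ S`. -/
def balCoord (S : Type w) (y : S) :
    BalTensor k (DiffOp k A) (Transpose k A A) (S →₀ DiffOp k A) →ₗ[k] Transpose k A A :=
  Submodule.liftQ _ (TensorProduct.lift (LinearMap.mk₂ k
      (fun (r : Transpose k A A) (v : S →₀ DiffOp k A) => op (v y) • r)
      (fun r r' v => smul_add _ _ _) (fun c r v => smul_comm _ _ _)
      (fun r v v' => by rw [Finsupp.add_apply, op_add, add_smul])
      (fun c r v => by rw [Finsupp.smul_apply, op_smul, smul_assoc]))) <|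
    Submodule.span_le.mpr <| by
      rintro _ ⟨r, δ, v, rfl⟩
      rw [SetLike.mem_coe, LinearMap.mem_ker, map_sub, TensorProduct.lift.tmul,
        TensorProduct.lift.tmul, LinearMap.mk₂_apply, LinearMap.mk₂_apply, Finsupp.smul_apply,
        smul_eq_mul, op_mul, mul_smul, sub_self]

theorem balCoord_tmul (S : Type w) (y : S) (r : Transpose k A A) (v : S →₀ DiffOp k A) :
    balCoord k A S y (BalTensor.tmul r v) = op (v y) • r := rfl

/-- Applying `balCoord` gives `1 · v(y) = 0` for each basis element `y`, so every coordinate lies in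
`∑ ∂_s 𝒟`. The finite support of `v` allows the choices to be assembled. -/
theorem exists_sum_dd_smul_of_tmul_eq_zero (S : Type w) (v : S →₀ DiffOp k A)
    (hv : (BalTensor.tmul (Transpose.of k A (1 : A)) v :
      BalTensor k (DiffOp k A) (Transpose k A A) (S →₀ DiffOp k A)) = 0) :
    ∃ V : Fin n → S →₀ DiffOp k A, v = ∑ s, dd k A s • V s := by
  have h : ∀ y, ∃ Q : Fin n → DiffOp k A, v y = ∑ s, dd k A s * Q s := fun y =>
    exists_sum_dd_mul_of_op_smul_one k A (v y) <| by
      rw [← balCoord_tmul k A S y, hv, map_zero]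
  choose Q hQ using h
  refine ⟨fun s => ∑ y ∈ v.support, Finsupp.single y (Q y s), ?_⟩
  simp only [Finset.smul_sum, Finsupp.smul_single, smul_eq_mul]
  rw [Finset.sum_comm]
  conv_lhs => rw [← Finsupp.sum_single v, Finsupp.sum]
  refine Finset.sum_congr rfl fun y _ => ?_
  rw [hQ, Finsupp.single_finsetSum]

section Balanced

variable {N : Type w} [AddCommGroup N] [Module k N] [Module (DiffOp k A) N]

theorem BalTensor.smul_tmul {D : Type*} [Ring D] [Algebra k D] {X : Type*} [AddCommGroup X]
    [Module k X] [Module Dᵐᵒᵖ X] {N : Type*} [AddCommGroup N] [Module k N] [Module D N]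
    (δ : D) (r : X) (v : N) :
    (BalTensor.tmul (op δ • r) v : BalTensor k D X N) = BalTensor.tmul r (δ • v) :=
  (Submodule.Quotient.eq _).mpr (Submodule.subset_span ⟨r, δ, v, rfl⟩)

variable (N) in
/-- The map `N → A^τ ⊗_𝒟 N`, `v ↦ 1 ⊗ v`. -/
def oneTmul : N →ₗ[k] BalTensor k (DiffOp k A) (Transpose k A A) N :=
  (balancedRel k (DiffOp k A) (Transpose k A A) N).mkQ ∘ₗ
    TensorProduct.mk k (Transpose k A A) N (Transpose.of k A (1 : A))

theorem oneTmul_apply (v : N) :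
    oneTmul k A N v = BalTensor.tmul (Transpose.of k A (1 : A)) v := rfl

theorem oneTmul_dd_smul (i : Fin n) (v : N) : oneTmul k A N (dd k A i • v) = 0 := by
  rw [oneTmul_apply, ← BalTensor.smul_tmul, op_dd_smul_one]
  show Submodule.Quotient.mk ((0 : Transpose k A A) ⊗ₜ[k] v) = _
  rw [TensorProduct.zero_tmul, Submodule.Quotient.mk_zero]

/-- The right module `A^τ` is generated by `1`, so a function in the left factor can be moved across
the tensor sign. -/
theorem oneTmul_surjective : Function.Surjective (oneTmul k A N) := by
  rw [← LinearMap.range_eq_top, Submodule.eq_top_iff']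
  intro z
  obtain ⟨z, rfl⟩ := Submodule.Quotient.mk_surjective _ z
  induction z using TensorProduct.induction_on with
  | zero => exact Submodule.zero_mem _
  | add a b ha hb => rw [Submodule.Quotient.mk_add]; exact Submodule.add_mem _ ha hb
  | tmul r v =>
    refine ⟨(DiffOp.mulOp ((Transpose.of k A).symm r) : DiffOp k A) • v, ?_⟩
    rw [oneTmul_apply, ← BalTensor.smul_tmul, op_mulOp_smul_one]
    rfl

/-- Coefficients of a boundary are sums of terms `± ∂_s v`, and `1 ⊗ ∂_s v = 1 · ∂_s ⊗ v = 0`. -/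
theorem oneTmul_eq_zero_of_mem [IsScalarTower k (DiffOp k A) N] {i : ℕ} (ω : DRForm n i N)
    (hω : ω ∈ dRhamBoundaries k A N i) (t) : oneTmul k A N (ω t) = 0 := by
  cases i with
  | zero => rw [(Submodule.mem_bot k).mp hω]; exact map_zero _
  | succ i =>
    obtain ⟨η, rfl⟩ := hω
    show oneTmul k A N (∑ s : {s // s ∈ t.1}, _) = 0
    rw [map_sum]
    exact Finset.sum_eq_zero fun s _ => by rw [map_zsmul, oneTmul_dd_smul, smul_zero]

end Balanced

/-- The kernel of `Ω^n(F) → A^τ ⊗_𝒟 F` for a free module `F`. -/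
theorem mem_dRhamBoundaries_of_oneTmul (S : Type w) {i : ℕ} (hi : i = n)
    (ω : DRForm n i (S →₀ DiffOp k A)) (hω : ∀ t, oneTmul k A _ (ω t) = 0) :
    ω ∈ dRhamBoundaries k A (S →₀ DiffOp k A) i := by
  have hu : (Finset.univ : Finset (Fin n)).card = i := by
    rw [Finset.card_univ, Fintype.card_fin, hi]
  obtain ⟨V, hV⟩ := exists_sum_dd_smul_of_tmul_eq_zero k A S _ (hω ⟨Finset.univ, hu⟩)
  convert top_mem_dRhamBoundaries k A hi V using 1
  funext t
  rw [← hV]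
  congr 1
  refine Subtype.ext ?_
  rw [← Finset.card_eq_iff_eq_univ, t.2, hi, Fintype.card_fin]

end FreeModules

/-! ### Chasing in a double complex -/

section DoubleComplex

variable {C : ℕ → ℕ → Type w} [∀ a p, AddCommGroup (C a p)]
  {d : ∀ a p, C a p →+ C (a + 1) p} {δ : ∀ a p, C a (p + 1) →+ C a p} {i : ℕ}

/-- If `δ y = d w_p`, then `δ (d y) = d (δ y) = d (d w_p) = 0`, so `d y` is again in the image of
`δ` by exactness. Hence `y` can serve as `w_{p+1}` and the construction continues. -/
theorem exists_total_cycle_of_bottom (hd : ∀ a p x, d (a + 1) p (d a p x) = 0)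
    (hdδ : ∀ a p x, d a p (δ a p x) = δ (a + 1) p (d a (p + 1) x))
    (hδ : ∀ a p x, δ a p x = 0 → ∃ y, δ a (p + 1) y = x)
    (w₀ : C (i + 0) 0) (h₀ : ∃ y, δ (i + 0 + 1) 0 y = d (i + 0) 0 w₀) :
    ∃ w : ∀ p, C (i + p) p, w 0 = w₀ ∧
      ∀ p, d (i + p) p (w p) = δ (i + p + 1) p (w (p + 1)) := by
  -- The subtype carries the invariant that `d x` lies in the image of `δ`, which the recursion
  -- needs at every stage.
  have step : ∀ p (x : {x : C (i + p) p // ∃ y, δ (i + p + 1) p y = d (i + p) p x}),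
      ∃ y : {y : C (i + (p + 1)) (p + 1) //
        ∃ z, δ (i + (p + 1) + 1) (p + 1) z = d (i + (p + 1)) (p + 1) y},
        d (i + p) p x.1 = δ (i + p + 1) p y.1 := by
    rintro p ⟨x, y, hy⟩
    refine ⟨⟨y, hδ _ _ _ ?_⟩, hy.symm⟩
    exact (hdδ (i + p + 1) p y).symm.trans (by rw [hy, hd])
  choose next hnext using step
  let W : ∀ p, {x : C (i + p) p // ∃ y, δ (i + p + 1) p y = d (i + p) p x} :=
    fun p => Nat.rec ⟨w₀, h₀⟩ (fun p x => next p x) p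
  exact ⟨fun p => (W p).1, rfl, fun p => hnext p (W p)⟩

/-- Descent from `p = j` by exactness in the `d`-direction. That exactness is not assumed in degree
`i + j`, so the first step is supplied by `hv`; the form `q + 1 = j` makes it empty when `j = 0`.
Only `v j` is prescribed in the conclusion. -/
theorem exists_total_cycle_of_top {j : ℕ}
    (hdδ : ∀ a p x, d a p (δ a p x) = δ (a + 1) p (d a (p + 1) x))
    (hδδ : ∀ a p x, δ a p (δ a (p + 1) x) = 0)
    (hrow : ∀ a p x, a + 1 < i + j → d (a + 1) p x = 0 → ∃ y, d a p y = x)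
    (htop : ∀ p, j ≤ p → Subsingleton (C (i + p + 1) p))
    (v : ∀ p, C (i + p) p)
    (hv : ∀ q, q + 1 = j → ∃ x, d (i + q) q x = δ (i + q + 1) q (v (q + 1))) :
    ∃ w : ∀ p, C (i + p) p, w j = v j ∧
      ∀ p, d (i + p) p (w p) = δ (i + p + 1) p (w (p + 1)) := by
  have key : ∀ m q, q + m = j → ∃ w : ∀ p, C (i + p) p, w j = v j ∧
      ∀ p, q ≤ p → d (i + p) p (w p) = δ (i + p + 1) p (w (p + 1)) := by
    intro m
    induction m with
    | zero =>
      intro q hq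
      exact ⟨v, rfl, fun p hp => (htop p (by omega)).elim _ _⟩
    | succ m ih =>
      intro q hq
      obtain ⟨w, hwj, hw⟩ := ih (q + 1) (by omega)
      obtain ⟨x, hx⟩ : ∃ x, d (i + q) q x = δ (i + q + 1) q (w (q + 1)) := by
        by_cases hqj : q + 1 = j
        · have := hv q hqj
          subst hqj
          rwa [← hwj] at this
        · refine hrow _ _ _ (by omega) ?_
          -- The element to be lifted is closed: `d (δ w_{q+1}) = δ (d w_{q+1}) = δ (δ w_{q+2}) =
          -- 0`.
          rw [hdδ]
          refine (congrArg _ (hw (q + 1) le_rfl)).trans ?_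
          exact hδδ _ _ _
      refine ⟨Function.update w q x, ?_, fun p hp => ?_⟩
      · rw [Function.update_of_ne (by omega), hwj]
      · rw [Function.update_of_ne (show p + 1 ≠ q by omega)]
        by_cases hpq : p = q
        · subst hpq
          rw [Function.update_self, hx]
        · rw [Function.update_of_ne hpq, hw p (by omega)]
  obtain ⟨w, h, hw⟩ := key j 0 (by omega)
  exact ⟨w, h, fun p => hw p (Nat.zero_le p)⟩

variable {B : ∀ a p, AddSubgroup (C a p)}

/-- If `w_p - δ u` is a boundary, applying `d` gives `δ (w_{p+1} - d u) = 0`. Exactness yields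
`w_{p+1} - d u = δ u'`, and so `w_{p+1} - δ u' = d u`. The subgroups `B` stand for the boundaries,
which in degree zero are not the range of a differential in the family. -/
theorem total_boundary_of_bottom
    (hdδ : ∀ a p x, d a p (δ a p x) = δ (a + 1) p (d a (p + 1) x))
    (hδ : ∀ a p x, δ a p x = 0 → ∃ y, δ a (p + 1) y = x)
    (hdB : ∀ a p, ∀ x ∈ B a p, d a p x = 0) (hB : ∀ a p x, d a p x ∈ B (a + 1) p)
    {w : ∀ p, C (i + p) p} (hw : ∀ p, d (i + p) p (w p) = δ (i + p + 1) p (w (p + 1)))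
    (h₀ : ∃ u, w 0 - δ (i + 0) 0 u ∈ B (i + 0) 0) (p : ℕ) :
    ∃ u, w p - δ (i + p) p u ∈ B (i + p) p := by
  induction p with
  | zero => exact h₀
  | succ p ih =>
    obtain ⟨u, hu⟩ := ih
    have h := hdB _ _ _ hu
    rw [map_sub, hw, hdδ, ← map_sub] at h
    obtain ⟨u', hu'⟩ := hδ _ _ _ h
    refine ⟨u', ?_⟩
    have e : w (p + 1) - δ (i + p + 1) (p + 1) u' = d (i + p) (p + 1) u := by
      rw [hu', sub_sub_cancel]
    exact e ▸ hB (i + p) (p + 1) u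

/-- The reverse descent: if `w_{q+1} - δ u = d y`, then `d (w_q - δ y) = δ (w_{q+1} - d y) = δ (δ u)
= 0`, and exactness below degree `i + j` makes `w_q - δ y` a boundary. -/
theorem total_boundary_of_top {j : ℕ}
    (hdδ : ∀ a p x, d a p (δ a p x) = δ (a + 1) p (d a (p + 1) x))
    (hδδ : ∀ a p x, δ a p (δ a (p + 1) x) = 0)
    (hrow : ∀ a p x, a < i + j → d a p x = 0 → x ∈ B a p)
    (hB : ∀ a p, ∀ x ∈ B (a + 1) p, ∃ y, d a p y = x)
    {w : ∀ p, C (i + p) p} (hw : ∀ p, d (i + p) p (w p) = δ (i + p + 1) p (w (p + 1)))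
    (hj : ∃ u, w j - δ (i + j) j u ∈ B (i + j) j) :
    ∃ u, w 0 - δ (i + 0) 0 u ∈ B (i + 0) 0 := by
  have key : ∀ m q, q + m = j → ∃ u, w q - δ (i + q) q u ∈ B (i + q) q := by
    intro m
    induction m with
    | zero => intro q hq; obtain rfl : q = j := hq; exact hj
    | succ m ih =>
      intro q hq
      obtain ⟨u, hu⟩ := ih (q + 1) (by omega)
      obtain ⟨y, hy⟩ := hB (i + q) (q + 1) _ hu
      refine ⟨y, hrow _ _ _ (by omega) ?_⟩
      rw [map_sub, hdδ, hy, hw, map_sub]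
      have e : δ (i + q + 1) q (δ (i + (q + 1)) (q + 1) u) = 0 := hδδ _ _ _
      rw [e, sub_zero, sub_self]
  exact key j 0 (by omega)

end DoubleComplex

/-! ### Linear relations -/

/-- A linear relation that is total and single-valued in both directions is the graph of a linear
equivalence. -/
theorem exists_linearEquiv_of_relation {k : Type u} [Field k] {U : Type v} {V : Type w}
    [AddCommGroup U] [Module k U] [AddCommGroup V] [Module k V] (G : Submodule k (U × V))
    (h₁ : ∀ c, ∃ y, (c, y) ∈ G) (h₂ : ∀ y, ∃ c, (c, y) ∈ G) (h₃ : ∀ y, (0, y) ∈ G → y = 0)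
    (h₄ : ∀ c, (c, 0) ∈ G → c = 0) : ∃ e : U ≃ₗ[k] V, ∀ c y, e c = y ↔ (c, y) ∈ G := by
  choose f hf using h₁
  -- Single-valuedness at zero extends to all classes by subtraction in the submodule `G`.
  have huniq : ∀ c y, (c, y) ∈ G → f c = y := by
    intro c y h
    refine sub_eq_zero.mp (h₃ _ ?_)
    have := G.sub_mem (hf c) h
    rwa [Prod.mk_sub_mk, sub_self] at this
  let F : U →ₗ[k] V :=
    { toFun := f
      map_add' := fun c c' => huniq _ _ (G.add_mem (hf c) (hf c'))
      map_smul' := fun a c => huniq _ _ (G.smul_mem a (hf c)) }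
  have hF : Function.Bijective F := by
    refine ⟨(injective_iff_map_eq_zero F).mpr fun c hc => h₄ c ?_, fun y => ?_⟩
    · have h := hf c
      rwa [show f c = 0 from hc] at h
    · obtain ⟨c, hc⟩ := h₂ y
      exact ⟨c, huniq c y hc⟩
  exact ⟨LinearEquiv.ofBijective F hF, fun c y => ⟨fun h => h ▸ hf c, huniq c y⟩⟩

/-! ### Functoriality of the de Rham complex -/

section MapForm

/-- `f` applied to each coefficient of a form. -/
def mapForm {n : ℕ} {N : Type*} [AddCommGroup N] {N' : Type*} [AddCommGroup N'] (f : N →+ N')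
    (i : ℕ) : DRForm n i N →+ DRForm n i N' where
  toFun ω s := f (ω s)
  map_zero' := funext fun _ => map_zero f
  map_add' ω η := funext fun s => map_add f (ω s) (η s)

variable {k : Type u} [Field k] {A : Type*} [CommRing A] [Algebra k A] {n : ℕ}
  [Coordinates k A n] {N : Type*} [AddCommGroup N] [Module k N] [Module (DiffOp k A) N]
  [IsScalarTower k (DiffOp k A) N] {A' : Type*} [CommRing A'] [Algebra k A']
  [Coordinates k A' n] {N' : Type*} [AddCommGroup N'] [Module k N'] [Module (DiffOp k A') N']
  [IsScalarTower k (DiffOp k A') N']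

/-- Only additivity and compatibility with each `∂_s` enter, and the two coordinate rings may
differ. This covers the resolution differentials, the augmentation and the maps over `𝒟 → 𝒟̂`. -/
theorem dRham_mapForm (f : N →+ N') (hf : ∀ s m, f (dd k A s • m) = dd k A' s • f m) (i : ℕ)
    (ω : DRForm n i N) :
    dRham k A' N' i (mapForm f i ω) = mapForm f (i + 1) (dRham k A N i ω) := by
  funext t
  show ∑ s : {s // s ∈ t.1}, _ = f (∑ s : {s // s ∈ t.1}, _)
  rw [map_sum]
  refine Finset.sum_congr rfl fun s _ => ?_
  rw [map_zsmul, hf]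
  rfl

theorem mapForm_mem_dRhamBoundaries (f : N →+ N')
    (hf : ∀ s m, f (dd k A s • m) = dd k A' s • f m) (i : ℕ) {ω : DRForm n i N}
    (h : ω ∈ dRhamBoundaries k A N i) : mapForm f i ω ∈ dRhamBoundaries k A' N' i := by
  cases i with
  | zero => rw [(Submodule.mem_bot k).mp h, map_zero]; exact Submodule.zero_mem _
  | succ i =>
    obtain ⟨η, rfl⟩ := h
    exact ⟨mapForm f i η, dRham_mapForm f hf i η⟩

theorem mapForm_surjective {f : N →+ N'} (hf : Function.Surjective f) (i : ℕ) :
    Function.Surjective (mapForm f i : DRForm n i N →+ DRForm n i N') :=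
  hf.comp_left

theorem exists_mem_dRhamBoundaries_mapForm_eq (f : N →+ N')
    (hf : ∀ s m, f (dd k A s • m) = dd k A' s • f m) (hs : Function.Surjective f) (i : ℕ)
    {ω : DRForm n i N'} (h : ω ∈ dRhamBoundaries k A' N' i) :
    ∃ η ∈ dRhamBoundaries k A N i, mapForm f i η = ω := by
  cases i with
  | zero => exact ⟨0, Submodule.zero_mem _, by rw [(Submodule.mem_bot k).mp h, map_zero]⟩
  | succ i =>
    obtain ⟨ω, rfl⟩ := h
    obtain ⟨η, rfl⟩ := mapForm_surjective hs i ω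
    exact ⟨_, ⟨η, rfl⟩, (dRham_mapForm f hf i η).symm⟩

theorem subsingleton_DRForm {i : ℕ} (hi : n < i) (N : Type*) : Subsingleton (DRForm n i N) := by
  refine ⟨fun ω η => funext fun t => ?_⟩
  have h := Finset.card_le_univ t.1
  rw [t.2, Fintype.card_fin] at h
  omega

theorem subsingleton_HdR {i : ℕ} (hi : n < i) : Subsingleton (HdR k A N i) := by
  have := subsingleton_DRForm hi N
  have : Subsingleton (LinearMap.ker (dRham k A N i)) := Subtype.val_injective.subsingleton
  exact (Submodule.Quotient.mk_surjective _).subsingleton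

end MapForm

/-! ### The free resolution with signs -/

section SignedResolution

variable (D : Type u) [Ring D] (N : Type v) [AddCommGroup N] [Module D N]

/-- The differential `F_{p+1} → F_p` with the sign `(-1)^{j+p}`. -/
def signedD (j p : ℕ) : freeRes D N (p + 1) →+ freeRes D N p :=
  (-1 : ℤ) ^ (j + p) • (freeRes.d D N p).toAddMonoidHom

variable {D N}

theorem signedD_apply (j p : ℕ) (v : freeRes D N (p + 1)) :
    signedD D N j p v = (-1 : ℤ) ^ (j + p) • freeRes.d D N p v := rfl

theorem neg_one_pow_smul_smul {V : Type*} [AddCommGroup V] (m : ℕ) (v : V) :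
    (-1 : ℤ) ^ m • (-1 : ℤ) ^ m • v = v := by
  rw [← mul_smul, ← mul_pow, neg_one_mul, neg_neg, one_pow, one_smul]

/-- The sign is its own inverse, so kernels agree with the unsigned ones; with the same fact for
ranges, exactness of the resolution carries over. -/
theorem signedD_eq_zero_iff (j p : ℕ) (v : freeRes D N (p + 1)) :
    signedD D N j p v = 0 ↔ freeRes.d D N p v = 0 := by
  refine ⟨fun h => ?_, fun h => by rw [signedD_apply, h, smul_zero]⟩
  rw [← neg_one_pow_smul_smul (j + p) (freeRes.d D N p v), ← signedD_apply, h, smul_zero]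

theorem exists_signedD_eq (j p : ℕ) {v : freeRes D N p}
    (hv : v ∈ LinearMap.range (freeRes.d D N p)) : ∃ u, signedD D N j p u = v := by
  obtain ⟨u, rfl⟩ := hv
  exact ⟨(-1 : ℤ) ^ (j + p) • u, by rw [signedD_apply, map_zsmul, neg_one_pow_smul_smul]⟩

theorem signedD_exact (j p : ℕ) {v : freeRes D N (p + 1)} (hv : signedD D N j p v = 0) :
    ∃ u, signedD D N j (p + 1) u = v :=
  exists_signedD_eq j (p + 1) (by
    rw [freeRes.exact_succ]; exact (signedD_eq_zero_iff j p v).mp hv)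

theorem signedD_exact_aug (j : ℕ) {v : freeRes D N 0} (hv : freeRes.aug D N v = 0) :
    ∃ u, signedD D N j 0 u = v :=
  exists_signedD_eq j 0 (by rw [freeRes.exact_zero]; exact hv)

theorem signedD_signedD (j p : ℕ) (v : freeRes D N (p + 2)) :
    signedD D N j p (signedD D N j (p + 1) v) = 0 := by
  rw [signedD_eq_zero_iff, signedD_apply, map_zsmul]
  have h : freeRes.d D N (p + 1) v ∈ LinearMap.ker (freeRes.d D N p) := by
    rw [← freeRes.exact_succ]; exact ⟨v, rfl⟩
  rw [LinearMap.mem_ker.mp h, smul_zero]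

theorem aug_signedD (j : ℕ) (v : freeRes D N 1) :
    freeRes.aug D N (signedD D N j 0 v) = 0 := by
  rw [signedD_apply, map_zsmul]
  have h : freeRes.d D N 0 v ∈ LinearMap.ker (freeRes.aug D N) := by
    rw [← freeRes.exact_zero]; exact ⟨v, rfl⟩
  rw [LinearMap.mem_ker.mp h, smul_zero]

theorem signedD_smul (j p : ℕ) (a : D) (v : freeRes D N (p + 1)) :
    signedD D N j p (a • v) = a • signedD D N j p v := by
  rw [signedD_apply, signedD_apply, map_smul, smul_comm]

end SignedResolution

/-! ### The comparison isomorphism -/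

section ComparisonEquiv

variable {k : Type u} [Field k] [CharZero k] {A : Type v} [CommRing A] [Algebra k A] {n : ℕ}
  [Coordinates k A n] {N : Type w} [AddCommGroup N] [Module k N] [Module (DiffOp k A) N]
  [IsScalarTower k (DiffOp k A) N]

theorem torD_oneTmul (p : ℕ) (v : freeRes (DiffOp k A) N (p + 1)) :
    torD k (DiffOp k A) (Transpose k A A) N p (oneTmul k A _ v)
      = oneTmul k A _ (freeRes.d (DiffOp k A) N p v) := rfl

/-- Once the sign is absorbed into the resolution differential, the cycle condition reads `d w_p = δ
w_{p+1}`. The sign does not depend on the form degree, so `d` and `δ` commute and the chases apply.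
-/
theorem isTotalCycle_iff {i j : ℕ} {w : ∀ p, DRForm n (i + p) (freeRes (DiffOp k A) N p)} :
    IsTotalCycle k A N i j w ↔ ∀ p, dRham k A (freeRes (DiffOp k A) N p) (i + p) (w p)
      = mapForm (signedD (DiffOp k A) N j p) (i + p + 1) (w (p + 1)) := Iff.rfl

variable (k A N) in
/-- The graph of the comparison map. -/
def comparisonGraph {i j : ℕ} (hij : i + j = n) :
    Submodule k (HdR k A N i × TorSpace k (DiffOp k A) (Transpose k A A) N j) where
  carrier := {cy | ∃ w, IsTotalCycle k A N i j w ∧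
    (∃ z : LinearMap.ker (dRham k A N i),
      z.1 = (fun s => freeRes.aug (DiffOp k A) N (w 0 s)) ∧ Submodule.Quotient.mk z = cy.1) ∧
    ∃ z : torCycles k (DiffOp k A) (Transpose k A A) N j,
      z.1 = BalTensor.tmul (Transpose.of k A (1 : A))
        (w j ⟨Finset.univ, by rw [Finset.card_univ, Fintype.card_fin, hij]⟩) ∧
      Submodule.Quotient.mk z = cy.2}
  zero_mem' := by
    refine ⟨0, isTotalCycle_iff.mpr fun p => ?_, ⟨0, ?_, rfl⟩, 0, ?_, rfl⟩
    · rw [Pi.zero_apply, map_zero, Pi.zero_apply]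
      exact (map_zero (mapForm (signedD (DiffOp k A) N j p) (i + p + 1))).symm
    · exact funext fun s => (map_zero (freeRes.aug (DiffOp k A) N)).symm
    · exact (map_zero (oneTmul k A _)).symm
  add_mem' := by
    rintro ⟨_, _⟩ ⟨_, _⟩ ⟨w, hw, ⟨z, hz, rfl⟩, y, hy, rfl⟩ ⟨w', hw', ⟨z', hz', rfl⟩, y', hy', rfl⟩
    refine ⟨w + w', isTotalCycle_iff.mpr fun p => ?_, ⟨z + z', ?_, rfl⟩, y + y', ?_, rfl⟩
    · rw [Pi.add_apply, map_add, isTotalCycle_iff.mp hw p, isTotalCycle_iff.mp hw' p]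
      exact (map_add (mapForm (signedD (DiffOp k A) N j p) (i + p + 1)) _ _).symm
    · rw [Submodule.coe_add, hz, hz']
      exact funext fun s => (map_add (freeRes.aug (DiffOp k A) N) _ _).symm
    · rw [Submodule.coe_add, hy, hy']
      exact (map_add (oneTmul k A _) _ _).symm
  smul_mem' := by
    rintro c ⟨_, _⟩ ⟨w, hw, ⟨z, hz, rfl⟩, y, hy, rfl⟩
    refine ⟨c • w, fun p => ?_, ⟨c • z, ?_, rfl⟩, c • y, ?_, rfl⟩
    · rw [Pi.smul_apply, map_smul, hw p]
      funext t
      show c • (-1 : ℤ) ^ (j + p) • freeRes.d (DiffOp k A) N p (w (p + 1) t)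
        = (-1 : ℤ) ^ (j + p) • freeRes.d (DiffOp k A) N p (c • w (p + 1) t)
      rw [LinearMap.map_smul_of_tower, smul_comm]
    · rw [Submodule.coe_smul, hz]
      exact funext fun s => (LinearMap.map_smul_of_tower (freeRes.aug (DiffOp k A) N) c _).symm
    · rw [Submodule.coe_smul, hy]
      exact (map_smul (oneTmul k A _) c _).symm

/-- The top component of a total cycle is a cycle in `A^τ ⊗_𝒟 F_•`. -/
theorem IsTotalCycle.oneTmul_mem {i j : ℕ} {w : ∀ p, DRForm n (i + p) (freeRes (DiffOp k A) N p)}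
    (hw : IsTotalCycle k A N i j w) (t) :
    oneTmul k A _ (w j t) ∈ torCycles k (DiffOp k A) (Transpose k A A) N j := by
  cases j with
  | zero => exact Submodule.mem_top
  | succ j =>
    show torD k (DiffOp k A) (Transpose k A A) N j _ = 0
    -- The square of the sign is inserted so that the total cycle equation can be used; it shows
    -- that the differential of `w_{j+1}` is, up to sign, a de Rham boundary, which `oneTmul` kills.
    rw [torD_oneTmul, ← neg_one_pow_smul_smul (j + 1 + j) (freeRes.d (DiffOp k A) N j (w (j + 1) t)),
      map_zsmul]
    have h := congrFun (hw j) t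
    have h' := oneTmul_eq_zero_of_mem k A (i := i + j + 1)
      (dRham k A (freeRes (DiffOp k A) N j) (i + j) (w j)) ⟨_, rfl⟩ t
    rw [h] at h'
    rw [h', smul_zero]

/-- The bottom component of a total cycle gives a closed form. -/
theorem IsTotalCycle.aug_mem {i j : ℕ} {w : ∀ p, DRForm n (i + p) (freeRes (DiffOp k A) N p)}
    (hw : IsTotalCycle k A N i j w) :
    mapForm (freeRes.aug (DiffOp k A) N).toAddMonoidHom i (w 0) ∈ LinearMap.ker (dRham k A N i) := by
  rw [LinearMap.mem_ker, dRham_mapForm (A := A) _ (fun s m => map_smul (freeRes.aug (DiffOp k A) N) _ _)]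
  refine (congrArg _ (hw 0)).trans (funext fun t => ?_)
  exact aug_signedD j (w 1 t)

theorem dRham_mapForm_signedD (j a p : ℕ)
    (x : DRForm n a (freeRes (DiffOp k A) N (p + 1))) :
    dRham k A _ a (mapForm (signedD (DiffOp k A) N j p) a x)
      = mapForm (signedD (DiffOp k A) N j p) (a + 1) (dRham k A _ a x) :=
  dRham_mapForm _ (fun _ _ => signedD_smul j p _ _) a x

theorem mapForm_signedD_exact (j a p : ℕ) (x : DRForm n a (freeRes (DiffOp k A) N (p + 1)))
    (hx : mapForm (signedD (DiffOp k A) N j p) a x = 0) :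
    ∃ y, mapForm (signedD (DiffOp k A) N j (p + 1)) a y = x := by
  choose y hy using fun t => signedD_exact j p (congrFun hx t)
  exact ⟨y, funext hy⟩

theorem mapForm_signedD_exact_aug (j a : ℕ) (x : DRForm n a (freeRes (DiffOp k A) N 0))
    (hx : mapForm (freeRes.aug (DiffOp k A) N).toAddMonoidHom a x = 0) :
    ∃ y, mapForm (signedD (DiffOp k A) N j 0) a y = x := by
  choose y hy using fun t => signedD_exact_aug j (congrFun hx t)
  exact ⟨y, funext hy⟩

theorem exists_isComparison {i j : ℕ} (hij : i + j = n) :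
    ∃ e : HdR k A N i ≃ₗ[k] TorSpace k (DiffOp k A) (Transpose k A A) N j, IsComparison hij e := by
  let dr : ∀ a p, DRForm n a (freeRes (DiffOp k A) N p) →+
      DRForm n (a + 1) (freeRes (DiffOp k A) N p) := fun a p => (dRham k A _ a).toAddMonoidHom
  let δ : ∀ a p, DRForm n a (freeRes (DiffOp k A) N (p + 1)) →+
      DRForm n a (freeRes (DiffOp k A) N p) := fun a p => mapForm (signedD (DiffOp k A) N j p) a
  let B : ∀ a p, AddSubgroup (DRForm n a (freeRes (DiffOp k A) N p)) := fun a p =>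
    (dRhamBoundaries k A _ a).toAddSubgroup
  let aug : freeRes (DiffOp k A) N 0 →+ N := (freeRes.aug (DiffOp k A) N).toAddMonoidHom
  have haug : ∀ s m, aug (dd k A s • m) = dd k A s • aug m := fun s m =>
    map_smul (freeRes.aug (DiffOp k A) N) _ _
  have haugs : Function.Surjective aug := freeRes.aug_surjective (DiffOp k A) N
  have hd : ∀ a p x, dr (a + 1) p (dr a p x) = 0 := fun a p x => dRham_dRham k A a x
  have hdδ : ∀ a p x, dr a p (δ a p x) = δ (a + 1) p (dr a (p + 1) x) := fun a p x =>
    dRham_mapForm_signedD j a p x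
  have hδ : ∀ a p x, δ a p x = 0 → ∃ y, δ a (p + 1) y = x := fun a p x =>
    mapForm_signedD_exact j a p x
  have hδδ : ∀ a p x, δ a p (δ a (p + 1) x) = 0 := fun a p x =>
    funext fun t => signedD_signedD j p (x t)
  have hrow : ∀ a p x, a < i + j → dr a p x = 0 → x ∈ B a p := fun a p x ha hx =>
    mem_dRhamBoundaries_of_free k A _ (hij ▸ ha) x hx
  have hu : (Finset.univ : Finset (Fin n)).card = i + j := by
    rw [Finset.card_univ, Fintype.card_fin, hij]
  have huniq : ∀ t : {s : Finset (Fin n) // s.card = i + j}, t = ⟨Finset.univ, hu⟩ := fun t =>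
    Subtype.ext (by rw [← Finset.card_eq_iff_eq_univ, t.2, hij, Fintype.card_fin])
  -- Membership in `comparisonGraph` is by definition the condition in `IsComparison`, so only the
  -- four properties of the relation remain.
  refine exists_linearEquiv_of_relation (comparisonGraph k A N hij) ?_ ?_ ?_ ?_
  · intro c
    obtain ⟨⟨z, hz⟩, rfl⟩ := Submodule.Quotient.mk_surjective _ c
    -- A closed form on `N` lifts to `Ω^i(F_0)`. The differential of the lift is killed by the
    -- augmentation, so it comes from `F_1` and the climb can start.
    obtain ⟨w₀, hw₀⟩ := mapForm_surjective haugs i z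
    obtain ⟨w, hw0, hw⟩ := exists_total_cycle_of_bottom (d := dr) (δ := δ) (i := i) hd hdδ hδ w₀
      (mapForm_signedD_exact_aug j _ _ <| by
        refine (dRham_mapForm (A := A) aug haug i w₀).symm.trans ?_
        rw [hw₀]
        exact hz)
    have hw' : IsTotalCycle k A N i j w := hw
    refine ⟨Submodule.Quotient.mk ⟨_, hw'.oneTmul_mem ⟨Finset.univ, hu⟩⟩, w, hw',
      ⟨⟨z, hz⟩, ?_, rfl⟩, _, rfl, rfl⟩
    rw [hw0]
    exact hw₀.symm
  · intro y
    obtain ⟨⟨z, hz⟩, rfl⟩ := Submodule.Quotient.mk_surjective _ y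
    obtain ⟨m, hm⟩ := oneTmul_surjective k A z
    -- The Tor cycle is `1 ⊗ m`, and `m` is placed in the top form degree. The differential of `m`
    -- is killed by `oneTmul`, since `1 ⊗ m` is a cycle; this makes it a de Rham boundary.
    obtain ⟨w, hwj, hw⟩ := exists_total_cycle_of_top (d := dr) (δ := δ) (i := i) (j := j) hdδ hδδ
      (fun a p x ha hx => hrow _ _ x ha hx)
      (fun p hp => subsingleton_DRForm (by omega) _)
      (Function.update 0 j fun _ => m) (by
        rintro q rfl
        rw [Function.update_self]
        refine mem_dRhamBoundaries_of_oneTmul k A _ (i := i + q + 1) hij _ fun t => ?_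
        show oneTmul k A _ ((-1 : ℤ) ^ (q + 1 + q) • freeRes.d (DiffOp k A) N q m) = 0
        rw [map_zsmul, ← torD_oneTmul, hm]
        have hz : torD k (DiffOp k A) (Transpose k A A) N q z = 0 := hz
        rw [hz, smul_zero])
    have hw' : IsTotalCycle k A N i j w := hw
    refine ⟨Submodule.Quotient.mk ⟨_, hw'.aug_mem⟩, w, hw', ⟨_, rfl, rfl⟩, ⟨z, hz⟩, ?_, rfl⟩
    rw [hwj, Function.update_self]
    exact hm.symm
  · rintro y ⟨w, hw, ⟨z, hz, hc⟩, y, hy, rfl⟩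
    have hz' : z.1 ∈ dRhamBoundaries k A N i :=
      (Submodule.Quotient.mk_eq_zero ((dRhamBoundaries k A N i).submoduleOf _)).mp hc
    -- The boundary `aug(w_0)` lifts to a boundary `η` over `F_0`, and `w_0 - η` then lies in the
    -- image of `δ`. Climbing to `p = j` makes `1 ⊗ w_j` a Tor boundary.
    obtain ⟨η, hη, hηz⟩ := exists_mem_dRhamBoundaries_mapForm_eq aug haug haugs i hz'
    obtain ⟨u, hu'⟩ := mapForm_signedD_exact_aug j i (w 0 - η) (by
      rw [map_sub, sub_eq_zero]
      exact (hηz.trans hz).symm)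
    obtain ⟨u, hu'⟩ := total_boundary_of_bottom (d := dr) (δ := δ) (B := B) hdδ hδ
      (fun a p x => dRham_eq_zero_of_mem k A a)
      (fun a p x => ⟨x, rfl⟩) hw
      ⟨u, by
        have e : w 0 - δ (i + 0) 0 u = η := by
          have : δ (i + 0) 0 u = w 0 - η := hu'
          rw [this, sub_sub_cancel]
        rw [e]; exact hη⟩ j
    refine (Submodule.Quotient.mk_eq_zero _).mpr ?_
    have h := oneTmul_eq_zero_of_mem k A _ hu' ⟨Finset.univ, hu⟩
    refine ⟨oneTmul k A _ ((-1 : ℤ) ^ (j + j) • u ⟨Finset.univ, hu⟩), ?_⟩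
    rw [torD_oneTmul, map_zsmul]
    refine Eq.trans ?_ hy.symm
    rw [Pi.sub_apply, map_sub, sub_eq_zero] at h
    exact h.symm
  · rintro c ⟨w, hw, ⟨z, hz, rfl⟩, y, hy, hy0⟩
    obtain ⟨v, hv⟩ : y.1 ∈ LinearMap.range (torD k (DiffOp k A) (Transpose k A A) N j) :=
      (Submodule.Quotient.mk_eq_zero ((LinearMap.range (torD k (DiffOp k A)
        (Transpose k A A) N j)).submoduleOf _)).mp hy0
    obtain ⟨m, rfl⟩ := oneTmul_surjective k A v
    -- If `1 ⊗ w_j` is the Tor boundary of `1 ⊗ m`, then `w_j` minus the differential of `m` is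
    -- killed by `oneTmul`, hence is a de Rham boundary. Descending to `p = 0` and augmenting
    -- removes the image of `δ`, so `aug(w_0)` is a boundary.
    obtain ⟨m', hm'⟩ := exists_signedD_eq j j ⟨m, rfl⟩
    obtain ⟨u, hu'⟩ := total_boundary_of_top (d := dr) (δ := δ) (B := B) (j := j) hdδ hδδ hrow
      (fun a p x hx => hx) hw
      ⟨fun _ => m', mem_dRhamBoundaries_of_oneTmul k A _ hij _ fun t => by
        show oneTmul k A _ (w j t - signedD (DiffOp k A) N j j m') = 0
        rw [hm', map_sub, ← torD_oneTmul, hv, huniq t, hy, sub_eq_zero]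
        rfl⟩
    refine (Submodule.Quotient.mk_eq_zero _).mpr ?_
    have h := mapForm_mem_dRhamBoundaries aug haug i hu'
    have e : mapForm aug i (w 0 - δ (i + 0) 0 u) = z.1 := by
      rw [hz]
      funext t
      show aug (w 0 t - signedD (DiffOp k A) N j 0 (u t)) = _
      rw [map_sub]
      have : aug (signedD (DiffOp k A) N j 0 (u t)) = 0 := aug_signedD j (u t)
      rw [this, sub_zero]
      rfl
    rw [e] at h
    exact h

end ComparisonEquiv

/-! ### Compatibility with completion -/

section CompatibilityWithCompletion

variable {k : Type u} [Field k] [CharZero k] {n : ℕ} {M : Type v} [AddCommGroup M] [Module k M]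
  [Module (PolyR k n) M] [Module (DiffOp k (PolyR k n)) M]
  [IsScalarTower k (DiffOp k (PolyR k n)) M]
  [IsScalarTower (PolyR k n) (DiffOp k (PolyR k n)) M]

theorem extendOp_dd (s : Fin n) : extendOp k n (dd k (PolyR k n) s) = dd k (PowR k n) s :=
  DiffOp.lift_dd _ _ _ _ s

/-- The map of resolutions is semilinear over `𝒟 → 𝒟̂`, which sends `∂_s` to `∂_s`; so it commutes
with the de Rham differentials as well as with those of the resolutions. -/
theorem IsTotalCycle.freeResMap_kappa {i j : ℕ}
    {w : ∀ p, DRForm n (i + p) (freeRes (DiffOp k (PolyR k n)) M p)}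
    (hw : IsTotalCycle k (PolyR k n) M i j w) :
    IsTotalCycle k (PowR k n) (Completion k n M) i j fun p =>
      mapForm (freeResMap (extendOp k n).toRingHom (kappaSemilinear k n M) p).toAddMonoidHom _
        (w p) := by
  intro p
  rw [dRham_mapForm (A := PolyR k n) _ fun s m => ?_, hw p]
  · funext t
    show freeResMap (extendOp k n).toRingHom (kappaSemilinear k n M) p
      ((-1 : ℤ) ^ (j + p) • freeRes.d _ M p (w (p + 1) t)) = _
    rw [map_zsmul, freeResMap_d]
    rfl
  · rw [← extendOp_dd]
    exact map_smulₛₗ (freeResMap (extendOp k n).toRingHom (kappaSemilinear k n M) p) _ _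

/-- A total cycle witnessing the value `e c` is carried by the map of resolutions to a total cycle
witnessing the required value of `e'`. Neither bijectivity nor linearity of the comparison maps
enters. -/
theorem IsComparison.naturality {i j : ℕ} (hij : i + j = n)
    {e : HdR k (PolyR k n) M i →
      TorSpace k (DiffOp k (PolyR k n)) (Transpose k (PolyR k n) (PolyR k n)) M j}
    {e' : HdR k (PowR k n) (Completion k n M) i →
      TorSpace k (DiffOp k (PowR k n)) (Transpose k (PowR k n) (PowR k n)) (Completion k n M) j}
    (he : IsComparison hij e) (he' : IsComparison hij e') (c : HdR k (PolyR k n) M i) :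
    e' (kappaCoh k n M i c) = iota k n M j (e c) := by
  obtain ⟨w, hw, ⟨z, hz, hzc⟩, y, hy, hyc⟩ := (he c (e c)).mp rfl
  rw [← hyc, ← hzc]
  refine (he' _ _).mpr ⟨_, hw.freeResMap_kappa, ⟨_, ?_, rfl⟩, _, ?_, rfl⟩
  · show (fun s => kappa k n (z.1 s)) = _
    rw [hz]
    funext s
    exact (freeResMap_aug (extendOp k n).toRingHom (kappaSemilinear k n M) (w 0 s)).symm
  · show torChainMap (extendOp k n) (transposeIncl k n) (transposeIncl_smul k n)
      (kappaSemilinear k n M) j y.1 = _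
    rw [hy]
    -- The representative `1 ⊗ w_j` is preserved because `R → R̂` sends `1` to `1`.
    have h1 : transposeIncl k n (Transpose.of k (PolyR k n) 1) = Transpose.of k (PowR k n) 1 :=
      map_one (polyToPow k n)
    rw [← h1]
    rfl

end CompatibilityWithCompletion

end

theorem mainTheorem5 (k : Type*) [Field k] [CharZero k] (n : ℕ)
    (M : Type*) [AddCommGroup M] [Module k M] [Module (PolyR k n) M]
    [Module (DiffOp k (PolyR k n)) M] [IsScalarTower k (DiffOp k (PolyR k n)) M]
    [IsScalarTower (PolyR k n) (DiffOp k (PolyR k n)) M] (i : ℕ) :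
    (∀ (j : ℕ) (hij : i + j = n),
      ∃ (e : HdR k (PolyR k n) M i ≃ₗ[k]
            TorSpace k (DiffOp k (PolyR k n)) (Transpose k (PolyR k n) (PolyR k n)) M j)
        (e' : HdR k (PowR k n) (Completion k n M) i ≃ₗ[k]
            TorSpace k (DiffOp k (PowR k n)) (Transpose k (PowR k n) (PowR k n))
              (Completion k n M) j),
        IsComparison hij e ∧ IsComparison hij e' ∧
          e'.toLinearMap ∘ₗ kappaCoh k n M i = iota k n M j ∘ₗ e.toLinearMap) ∧
    (n < i → Subsingleton (HdR k (PolyR k n) M i) ∧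
      Subsingleton (HdR k (PowR k n) (Completion k n M) i)) := by
  refine ⟨fun j hij => ?_, fun hi => ⟨subsingleton_HdR hi, subsingleton_HdR hi⟩⟩
  -- Both horizontal maps are instances of one theorem, for polynomial and for power series
  -- coordinates.
  obtain ⟨e, he⟩ := exists_isComparison (k := k) (A := PolyR k n) (N := M) hij
  obtain ⟨e', he'⟩ := exists_isComparison (k := k) (A := PowR k n) (N := Completion k n M) hij
  exact ⟨e, e', he, he', LinearMap.ext fun c => he.naturality hij he' c⟩
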